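/- **Notation.** For a dataset $S=(x_1,\dots,x_n)$ and $\phi:\mathcal X\to[0,1]$ let $\mathcal E_S[\phi]=\frac1n\sum_{i}\phi(x_i)$; for a probability distribution $\mathcal P$ on $\mathcal X$ let $\mathcal P[\phi]=\mathbb E_{x\sim\mathcal P}[\phi(x)]$. $\mathrm{Lap}(b)$ is the Laplace distribution with density $\frac1{2b}e^{-|x|/b}$. **Thresholdout** has as input a training set $S_t$, a holdout set $S$, a threshold $T$, a noise rate $\sigma$ and a budget $B\in\mathbb N$. It samples $\gamma\sim\mathrm{Lap}(2\sigma)$ and sets $\hat T\leftarrow T+\gamma$. For each query $\phi:\mathcal X\to[0,1]$: if $B<1$ it outputs $\bot$; otherwise it samples $\eta\sim\mathrm{Lap}(4\sigma)$, and if $|\mathcal E_{S}[\phi]-\mathcal E_{S_t}[\phi]|>\hat T+\eta$ it samples $\xi\sim\mathrm{Lap}(\sigma)$ and $\gamma\sim\mathrm{Lap}(2\sigma)$, sets $B\leftarrow B-1$ and $\hat T\leftarrow T+\gamma$, and outputs $\mathcal E_{S}[\phi]+\xi$; else it outputs $\mathcal E_{S_t}[\phi]$. All noise variables are independent of each other and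 of $S$. **Theorem.** Let $\beta,\tau>0$ and let $m\ge B>0$ be integers. Set $T=3\tau/4$ and $\sigma=\tau/(96\ln(4m/\beta))$. Let $S$ be a holdout set of $n$ points drawn i.i.d. from a distribution $\mathcal P$ on $\mathcal X$ and let $S_t$ be any fixed dataset over $\mathcal X$. Let a (possibly randomized) analyst with access to $S_t$, whose randomness is independent of $S$ and of the noise, adaptively choose functions $\phi_1,\dots,\phi_m:\mathcal X\to[0,1]$ (each may depend on the previous answers) while interacting with Thresholdout with inputs $S_t,S,T,\sigma,B$; let $a_i$ be the answer to $\phi_i$, and let $$Z_i=\bigl|\{j\le i:\ |\mathcal P[\phi_j]-\mathcal E_{S_t}[\phi_j]|>\tau/2\}\bigr|.$$ Put $$n_0(B,\sigma,\tau,\beta)=\max\Bigl\{\tfrac{2B}{\sigma\tau},\ \tfrac{\ln(6/\beta)}{\tau^2}\Bigr\},\qquad n_1(B,\sigma,\tau,\beta)=\frac{80\sqrt{B\ln(1/(\tau\beta))}}{\tau\sigma}.$$ 1. If $n\ge N:=\min\{n_0(B,\sigma,\tau/8,\beta/(2m)),\ n_1(B,\sigma,\tau/8,\beta/(2m))\}$,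 then $$\Pr\bigl[\exists i\le m:\ Z_i<B\ \text{ and }\ (a_i=\bot\ \text{ or }\ |a_i-\mathcal P[\phi_i]|\ge\tau)\bigr]\le\beta .$$ (When $\ln(1/(\tau\beta))$ in $n_1$ is negative, the square root is read as $0$.) 2. There is an absolute constant $C$ such that, whenever $0<\tau\le1$ and $0<\beta\le m/2$, $$N\ \le\ C\,\frac{\ln(m/\beta)}{\tau^2}\cdot\min\Bigl\{B,\ \sqrt{B\,\ln\bigl(m/(\tau\beta)\bigr)}\Bigr\}.$$ -/

import Mathlib

open MeasureTheory

/-- The Laplace distribution `Lap(b)`: density `x ↦ exp (-|x| / b) / (2 b)` for `b > 0`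
(for `b ≤ 0`, by convention, the point mass at `0`). -/
noncomputable def laplaceMeasure (b : ℝ) : Measure ℝ :=
  if 0 < b then
    volume.withDensity (fun x => ENNReal.ofReal (Real.exp (-|x| / b) / (2 * b)))
  else Measure.dirac 0

theorem isProbabilityMeasure_laplaceMeasure (b : ℝ) :
    IsProbabilityMeasure (laplaceMeasure b) := by
  unfold laplaceMeasure
  split_ifs with hb
  · have hI : IntegrableOn (fun x : ℝ => Real.exp (-(1 / b) * x)) (Set.Ioi 0) :=
      integrableOn_exp_mul_Ioi (by simpa using hb) 0
    have hv : ∫ x : ℝ, Real.exp (-(1 / b) * |x|) = 2 * b := by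
      rw [integral_comp_abs (f := fun x => Real.exp (-(1 / b) * x)),
        integral_exp_mul_Ioi (by simpa using hb) 0]
      field_simp
      simp
    have hint : Integrable (fun x : ℝ => Real.exp (-(1 / b) * |x|)) := by
      by_contra h
      rw [integral_undef h] at hv
      linarith
    have heq : (fun x : ℝ => Real.exp (-|x| / b) / (2 * b)) =
        fun x => Real.exp (-(1 / b) * |x|) / (2 * b) := by
      funext x
      congr 2
      ring
    refine ⟨?_⟩
    rw [withDensity_apply _ MeasurableSet.univ, Measure.restrict_univ]
    simp only [fun x : ℝ => congrFun heq x]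
    rw [← ofReal_integral_eq_lintegral_ofReal (hint.div_const _)
        (Filter.Eventually.of_forall fun x => by positivity),
      integral_div, hv, div_self (by positivity), ENNReal.ofReal_one]
  · infer_instance

instance instIsProbabilityMeasureLaplaceMeasure (b : ℝ) :
    IsProbabilityMeasure (laplaceMeasure b) :=
  isProbabilityMeasure_laplaceMeasure b

/-- The average `(1/n) ∑ᵢ φ(xᵢ)` of `φ` on the dataset `S = (x₁, …, xₙ)`. -/
noncomputable def empiricalMean {X : Type*} {n : ℕ} (S : Fin n → X) (φ : X → ℝ) : ℝ :=
  (∑ i, φ (S i)) / n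

namespace Thresholdout

/-- An answer of Thresholdout: `Sum.inl a` is the numerical answer `a`, and `Sum.inr ()` is `⊥`. -/
abbrev Answer : Type := ℝ ⊕ Unit

/-- The internal state: the remaining budget `B` and the current noisy threshold `T̂`. -/
structure State where
  budget : ℕ
  threshold : ℝ

/-- The noise variables `(η, ξ, γ)` available for one query. -/
abbrev StepNoise : Type := ℝ × ℝ × ℝ

/-- Treatment of a single query `φ`: if the budget is exhausted, output `⊥`. Otherwise, if
`|E_S[φ] - E_{S_t}[φ]| > T̂ + η`, then decrease the budget, set `T̂ = T + γ` and output
`E_S[φ] + ξ`; else output `E_{S_t}[φ]`. -/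
noncomputable def step {X : Type*} {n t : ℕ} (S : Fin n → X) (St : Fin t → X) (T : ℝ)
    (s : State) (φ : X → ℝ) (z : StepNoise) : Answer × State :=
  if s.budget < 1 then (Sum.inr (), s)
  else if |empiricalMean S φ - empiricalMean St φ| > s.threshold + z.1 then
    (Sum.inl (empiricalMean S φ + z.2.1), ⟨s.budget - 1, T + z.2.2⟩)
  else (Sum.inl (empiricalMean St φ), s)

/-- An analyst asking `m` adaptively chosen queries `X → [0,1]`: the `i`-th query is a function of
the analyst's internal randomness `ω : Ω` and of the answers to the earlier queries. -/
structure Analyst (X Ω : Type*) [MeasurableSpace X] [MeasurableSpace Ω] (m : ℕ) where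
  query : (i : Fin m) → Ω → (Fin (i : ℕ) → Answer) → X → ℝ
  query_mem : ∀ i ω h x, query i ω h x ∈ Set.Icc (0 : ℝ) 1
  measurable_query : ∀ i : Fin m,
    Measurable fun p : Ω × (Fin (i : ℕ) → Answer) × X => query i p.1 p.2.1 p.2.2

section Interaction

variable {X Ω : Type*} [MeasurableSpace X] [MeasurableSpace Ω] {m n t : ℕ}

/-- All the randomness of an interaction: the analyst's internal randomness, the holdout set, the
initial noise `γ` in the threshold, and the noise variables for every query. -/
abbrev Sample (X Ω : Type*) (m n : ℕ) : Type _ :=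
  Ω × (Fin n → X) × ℝ × (Fin m → StepNoise)

/-- The joint law of the randomness: all components are independent, the holdout set consists of
`n` i.i.d. points of law `P`, and `γ ∼ Lap(2σ)`, `η ∼ Lap(4σ)`, `ξ ∼ Lap(σ)`. -/
noncomputable def law (μ : Measure Ω) (P : Measure X) (σ : ℝ) (m n : ℕ) :
    Measure (Sample X Ω m n) :=
  μ.prod ((Measure.pi fun _ : Fin n => P).prod ((laplaceMeasure (2 * σ)).prod
    (Measure.pi fun _ : Fin m =>
      (laplaceMeasure (4 * σ)).prod ((laplaceMeasure σ).prod (laplaceMeasure (2 * σ))))))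

/-- The answers to the first `i` queries and the state of Thresholdout after them. -/
noncomputable def run (A : Analyst X Ω m) (St : Fin t → X) (B : ℕ) (T : ℝ) (p : Sample X Ω m n) :
    (i : ℕ) → i ≤ m → (Fin i → Answer) × State
  | 0, _ => (Fin.elim0, ⟨B, T + p.2.2.1⟩)
  | i + 1, hi =>
    let prev := run A St B T p i (Nat.le_of_succ_le hi)
    let out := step p.2.1 St T prev.2 (A.query ⟨i, hi⟩ p.1 prev.1) (p.2.2.2 ⟨i, hi⟩)
    (Fin.snoc prev.1 out.1, out.2)

/-- The `i`-th query `φ_i` chosen by the analyst. -/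
noncomputable def query (A : Analyst X Ω m) (St : Fin t → X) (B : ℕ) (T : ℝ) (p : Sample X Ω m n)
    (i : Fin m) : X → ℝ :=
  A.query i p.1 (run A St B T p i i.isLt.le).1

/-- The answer `a_i` of Thresholdout to the `i`-th query. -/
noncomputable def answer (A : Analyst X Ω m) (St : Fin t → X) (B : ℕ) (T : ℝ) (p : Sample X Ω m n)
    (i : Fin m) : Answer :=
  (run A St B T p (i + 1) i.isLt).1 (Fin.last i)

open Classical in
/-- The counter of overfitting
`Z_i = |{j ≤ i : |P[φ_j] - E_{S_t}[φ_j]| > τ / 2}|`. -/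
noncomputable def overfitCount (P : Measure X) (A : Analyst X Ω m) (St : Fin t → X) (B : ℕ)
    (T τ : ℝ) (p : Sample X Ω m n) (i : Fin m) : ℕ :=
  (Finset.univ.filter fun j : Fin m =>
    j ≤ i ∧ |∫ x, query A St B T p j x ∂P - empiricalMean St (query A St B T p j)| > τ / 2).card

end Interaction

/-- `n₀(B, σ, τ, β) = max {2 B / (σ τ), ln (6 / β) / τ²}`. -/
noncomputable def n₀ (B σ τ β : ℝ) : ℝ :=
  max (2 * B / (σ * τ)) (Real.log (6 / β) / τ ^ 2)

/-- `n₁(B, σ, τ, β) = 80 √(B ln (1 / (τ β))) / (τ σ)`. -/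
noncomputable def n₁ (B σ τ β : ℝ) : ℝ :=
  80 * Real.sqrt (B * Real.log (1 / (τ * β))) / (τ * σ)

/-- The noise rate `σ = τ / (96 ln (4 m / β))`. -/
noncomputable def noiseRate (m : ℕ) (τ β : ℝ) : ℝ :=
  τ / (96 * Real.log (4 * m / β))

/-- The sample size `min {n₀(B, σ, τ/8, β/(2m)), n₁(B, σ, τ/8, β/(2m))}` for
`σ = τ / (96 ln (4 m / β))`. -/
noncomputable def sampleBound (m B : ℕ) (τ β : ℝ) : ℝ :=
  min (n₀ B (noiseRate m τ β) (τ / 8) (β / (2 * m)))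
    (n₁ B (noiseRate m τ β) (τ / 8) (β / (2 * m)))

end Thresholdout

/-!
Accuracy of Thresholdout. If all noise variables are small and every query `φ_j` has a holdout mean
within `τ / 8` of its expectation, then each query that exceeds the noisy threshold has an
expectation at distance more than `τ / 2` from its training mean. So the budget spent is at most
the overfitting count `Z`, and as long as `Z < B` the answers are numbers at distance less than `τ`
from the truth (`Thresholdout.exists_answer_of_good`). The Laplace tails dispose of the noise, and
what remains is to bound, for every `j`, the probability that the adaptively chosen query `φ_j` has
a holdout mean far from its expectation. This follows from the differential privacy of the history
of answers as a function of the holdout set, in two ways.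

*Privacy.* The interaction is described by value functions computed backwards from the final
history (`epochValue`, `budgetValue`), and `lintegral_run_eq_budgetValue` identifies them with
expectations over the noise. One epoch, up to the next query above the threshold, is
`2 / (σ n)`-differentially private by the sparse vector argument (`epochStart_le`). Over `B` epochs
the privacy losses add up to `2 B / (σ n)` (`budgetValue_le`). Alternatively, the two-sided bound for
one epoch gives the Hölder-type inequality `E f ^ p ≤ C (E' f) ^ p` with `p = 1 - 1 / α` and
`log C` quadratic in the privacy loss (`epochStart_rpow_le`). It composes over the epochs
(`budgetValue_le_rpow`), and Young's inequality turns it into approximate privacy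
(`budgetValue_le_linear`).

*Generalization.* Under `ε`-differential privacy with `ε ≤ τ` the deviation exceeds `τ` with
probability at most `exp (-n τ²)` (`lintegral_measure_gap_le_of_pure`): conditionally on the output,
a sample point is tilted by at most `exp ε`, so that its exponential moment of order `μ` obeys
Hoeffding's bound with `ε + μ` in place of `μ`. The sample points are treated one at a time by
exchanging them with a fresh point. This gives the sample size `n₀`. Under approximate privacy the
joint law of sample and output is reweighted by a truncated exponential function of the deviation
(`lintegral_measure_gap_le_of_approx`). If large deviations had probability more than `β`, the
reweighted mean deviation would be at least of order `τ`, whereas the same exchange argument keeps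
it small. This gives the sample size `n₁`.
-/

open scoped ENNReal

/-! ### The Laplace distribution -/

lemma lintegral_laplaceMeasure {b : ℝ} (hb : 0 < b) {h : ℝ → ℝ≥0∞} (hh : Measurable h) :
    ∫⁻ x, h x ∂laplaceMeasure b =
      ∫⁻ x, ENNReal.ofReal (Real.exp (-|x| / b) / (2 * b)) * h x := by
  rw [laplaceMeasure, if_pos hb, lintegral_withDensity_eq_lintegral_mul _ (by fun_prop) hh]
  rfl

/-- Translating the Laplace distribution by `c` changes its density by a factor of at most
`exp (|c| / b)`. -/
lemma lintegral_laplaceMeasure_add_le {b : ℝ} (hb : 0 < b) {c r : ℝ} (hc : |c| ≤ r)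
    {h : ℝ → ℝ≥0∞} (hh : Measurable h) :
    ∫⁻ x, h (x + c) ∂laplaceMeasure b ≤
      ENNReal.ofReal (Real.exp (r / b)) * ∫⁻ x, h x ∂laplaceMeasure b := by
  rw [lintegral_laplaceMeasure hb hh, lintegral_laplaceMeasure hb (h := fun x => h (x + c)) (by fun_prop),
    ← lintegral_const_mul _ (by fun_prop),
    ← lintegral_sub_right_eq_self
      (fun x => ENNReal.ofReal (Real.exp (-|x| / b) / (2 * b)) * h (x + c)) c]
  refine lintegral_mono fun x => ?_
  rw [sub_add_cancel, ← mul_assoc, ← ENNReal.ofReal_mul (Real.exp_pos _).le, ← mul_div_assoc,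
    ← Real.exp_add, ← add_div]
  gcongr
  have := abs_sub_abs_le_abs_sub x (x - c)
  rw [sub_sub_cancel] at this
  linarith

lemma laplaceMeasure_abs_ge_le {b : ℝ} (hb : 0 < b) {a : ℝ} (ha : 0 ≤ a) :
    laplaceMeasure b {x | a ≤ |x|} ≤ ENNReal.ofReal (2 * Real.exp (-a / b)) := by
  -- on `x ≥ a` the density at `x` is `exp (-a / b)` times the density at `x - a`
  have key : ∀ c : ℝ, |c| = a → ∀ s : Set ℝ, MeasurableSet s → (∀ x ∈ s, |x| = |x - c| + a) →
      laplaceMeasure b s ≤ ENNReal.ofReal (Real.exp (-a / b)) := by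
    intro c _ s hs hx
    have h1 : ∫⁻ x, ENNReal.ofReal (Real.exp (-|x| / b) / (2 * b)) = 1 := by
      have := lintegral_laplaceMeasure hb (h := fun _ => 1) measurable_const
      simpa using this.symm
    rw [← lintegral_indicator_one hs, lintegral_laplaceMeasure hb (measurable_one.indicator hs)]
    calc ∫⁻ x, ENNReal.ofReal (Real.exp (-|x| / b) / (2 * b)) * s.indicator 1 x
        ≤ ∫⁻ x, ENNReal.ofReal (Real.exp (-a / b)) *
            ENNReal.ofReal (Real.exp (-|x - c| / b) / (2 * b)) := by
          refine lintegral_mono fun x => ?_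
          by_cases hxs : x ∈ s
          · rw [Set.indicator_of_mem hxs, Pi.one_apply, mul_one,
              ← ENNReal.ofReal_mul (Real.exp_pos _).le, ← mul_div_assoc, ← Real.exp_add,
              ← add_div, hx x hxs]
            apply le_of_eq
            ring_nf
          · simp [hxs]
      _ = _ := by
          rw [lintegral_const_mul _ (by fun_prop), lintegral_sub_right_eq_self
            (fun x => ENNReal.ofReal (Real.exp (-|x| / b) / (2 * b))) c, h1, mul_one]
  have hsub : {x : ℝ | a ≤ |x|} ⊆ Set.Ici a ∪ Set.Iic (-a) := by
    intro x hx
    rcases le_abs.1 (show a ≤ |x| from hx) with h | h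
    · exact Or.inl h
    · exact Or.inr (by simp only [Set.mem_Iic]; linarith)
  calc laplaceMeasure b {x | a ≤ |x|}
      ≤ laplaceMeasure b (Set.Ici a) + laplaceMeasure b (Set.Iic (-a)) :=
        (measure_mono hsub).trans (measure_union_le _ _)
    _ ≤ ENNReal.ofReal (Real.exp (-a / b)) + ENNReal.ofReal (Real.exp (-a / b)) := by
        refine add_le_add (key a (abs_of_nonneg ha) _ measurableSet_Ici fun x hx => ?_)
          (key (-a) (by rw [abs_neg, abs_of_nonneg ha]) _ measurableSet_Iic fun x hx => ?_)
        · simp only [Set.mem_Ici] at hx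
          rw [abs_of_nonneg (by linarith), abs_of_nonneg (by linarith)]
          ring
        · simp only [Set.mem_Iic] at hx
          rw [abs_of_nonpos (by linarith), abs_of_nonpos (by linarith)]
          ring
    _ = _ := by rw [← ENNReal.ofReal_add (by positivity) (by positivity), two_mul]

namespace Thresholdout

/-! ### Values of the interaction as seen from an intermediate history -/

lemma measurable_snoc (i : ℕ) : Measurable fun p : (Fin i → Answer) × Answer =>
    (Fin.snoc p.1 p.2 : Fin (i + 1) → Answer) := by
  refine measurable_pi_iff.2 fun j => ?_
  refine Fin.lastCases ?_ (fun j => ?_) j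
  · simpa using measurable_snd
  · simpa [Function.comp_def] using
      (measurable_pi_apply j).comp (measurable_fst (α := Fin i → Answer) (β := Answer))

/-- The expected payoff of one epoch of Thresholdout, that is, up to and including the first query
that exceeds the current noisy threshold `θ`, when `k` queries remain after the history `hist` of
length `i`. The functions `e` and `f` give the holdout and the training mean of the query asked
after a history. The payoff is `G k' i' hist'` if `k'` queries remain at the end of the epoch. -/
noncomputable def epochValue (σ : ℝ) (e f : (i : ℕ) → (Fin i → Answer) → ℝ)
    (G : ℕ → (i : ℕ) → (Fin i → Answer) → ℝ≥0∞) :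
    ℕ → (i : ℕ) → (Fin i → Answer) → ℝ → ℝ≥0∞
  | 0, i, hist, _ => G 0 i hist
  | k + 1, i, hist, θ =>
    ∫⁻ η, (if θ + η < |e i hist - f i hist| then
        ∫⁻ ξ, G k (i + 1) (Fin.snoc hist (Sum.inl (e i hist + ξ))) ∂laplaceMeasure σ
      else epochValue σ e f G k (i + 1) (Fin.snoc hist (Sum.inl (f i hist))) θ)
      ∂laplaceMeasure (4 * σ)

/-- The expected payoff of one epoch that starts with a fresh noisy threshold. -/
noncomputable def epochStart (σ T : ℝ) (e f : (i : ℕ) → (Fin i → Answer) → ℝ)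
    (G : ℕ → (i : ℕ) → (Fin i → Answer) → ℝ≥0∞) (k i : ℕ) (hist : Fin i → Answer) : ℝ≥0∞ :=
  ∫⁻ γ, epochValue σ e f G k i hist (T + γ) ∂laplaceMeasure (2 * σ)

/-- The payoff if all of the `k` remaining queries are answered by `⊥`. -/
noncomputable def exhaustedValue (h : (i : ℕ) → (Fin i → Answer) → ℝ≥0∞) :
    ℕ → (i : ℕ) → (Fin i → Answer) → ℝ≥0∞
  | 0, i, hist => h i hist
  | k + 1, i, hist => exhaustedValue h k (i + 1) (Fin.snoc hist (Sum.inr ()))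

/-- The expectation of the payoff `h` of the final history when `k` queries remain, the remaining
budget is `b` and a fresh noisy threshold is drawn. -/
noncomputable def budgetValue (σ T : ℝ) (e f : (i : ℕ) → (Fin i → Answer) → ℝ)
    (h : (i : ℕ) → (Fin i → Answer) → ℝ≥0∞) :
    ℕ → ℕ → (i : ℕ) → (Fin i → Answer) → ℝ≥0∞
  | 0 => exhaustedValue h
  | b + 1 => epochStart σ T e f (budgetValue σ T e f h b)

section Values

variable {σ T d : ℝ} {e e' f : (i : ℕ) → (Fin i → Answer) → ℝ}
  {G G' : ℕ → (i : ℕ) → (Fin i → Answer) → ℝ≥0∞} {h : (i : ℕ) → (Fin i → Answer) → ℝ≥0∞}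

lemma measurable_noisyAnswer (he : ∀ i, Measurable (e i)) (hG : ∀ k i, Measurable (G k i))
    (k i : ℕ) : Measurable fun q : (Fin i → Answer) × ℝ =>
      G k (i + 1) (Fin.snoc q.1 (Sum.inl (e i q.1 + q.2))) := by
  refine (hG k (i + 1)).comp ((measurable_snoc i).comp (measurable_fst.prodMk ?_))
  exact measurable_inl.comp (((he i).comp measurable_fst).add measurable_snd)

lemma measurable_epochValue (he : ∀ i, Measurable (e i)) (hf : ∀ i, Measurable (f i))
    (hG : ∀ k i, Measurable (G k i)) (k i : ℕ) :
    Measurable fun p : (Fin i → Answer) × ℝ => epochValue σ e f G k i p.1 p.2 := by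
  induction k generalizing i with
  | zero => exact (hG 0 i).comp measurable_fst
  | succ k ih =>
    simp only [epochValue]
    refine Measurable.lintegral_prod_right' (f := fun q : ((Fin i → Answer) × ℝ) × ℝ =>
      if q.1.2 + q.2 < |e i q.1.1 - f i q.1.1| then
        ∫⁻ ξ, G k (i + 1) (Fin.snoc q.1.1 (Sum.inl (e i q.1.1 + ξ))) ∂laplaceMeasure σ
      else epochValue σ e f G k (i + 1) (Fin.snoc q.1.1 (Sum.inl (f i q.1.1))) q.1.2) ?_
    have he1 : Measurable fun q : ((Fin i → Answer) × ℝ) × ℝ => e i q.1.1 :=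
      (he i).comp (measurable_fst.comp measurable_fst)
    have hf1 : Measurable fun q : ((Fin i → Answer) × ℝ) × ℝ => f i q.1.1 :=
      (hf i).comp (measurable_fst.comp measurable_fst)
    refine Measurable.ite (measurableSet_lt (by fun_prop)
      (continuous_abs.measurable.comp (he1.sub hf1))) ?_ ?_
    · exact (measurable_noisyAnswer he hG k i).lintegral_prod_right'.comp
        (measurable_fst.comp measurable_fst)
    · refine (ih (i + 1)).comp (((measurable_snoc i).comp
        ((measurable_fst.comp measurable_fst).prodMk (measurable_inl.comp hf1))).prodMk ?_)
      fun_prop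

lemma measurable_epochStart (he : ∀ i, Measurable (e i)) (hf : ∀ i, Measurable (f i))
    (hG : ∀ k i, Measurable (G k i)) (k i : ℕ) : Measurable (epochStart σ T e f G k i) := by
  refine Measurable.lintegral_prod_right' (f := fun q : (Fin i → Answer) × ℝ =>
    epochValue σ e f G k i q.1 (T + q.2)) ?_
  exact (measurable_epochValue he hf hG k i).comp
    (measurable_fst.prodMk (measurable_snd.const_add T))

lemma measurable_exhaustedValue (hh : ∀ i, Measurable (h i)) (k i : ℕ) :
    Measurable (exhaustedValue h k i) := by
  induction k generalizing i with
  | zero => exact hh i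
  | succ k ih =>
    exact (ih (i + 1)).comp ((measurable_snoc i).comp (measurable_id.prodMk measurable_const))

lemma measurable_budgetValue (he : ∀ i, Measurable (e i)) (hf : ∀ i, Measurable (f i))
    (hh : ∀ i, Measurable (h i)) (b k i : ℕ) : Measurable (budgetValue σ T e f h b k i) := by
  induction b generalizing k i with
  | zero => exact measurable_exhaustedValue hh k i
  | succ b ih => exact measurable_epochStart he hf ih k i

lemma epochValue_mono (hGG : ∀ k i hist, G k i hist ≤ G' k i hist) (k i : ℕ)
    (hist : Fin i → Answer) (θ : ℝ) :
    epochValue σ e f G k i hist θ ≤ epochValue σ e f G' k i hist θ := by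
  induction k generalizing i with
  | zero => exact hGG _ _ _
  | succ k ih =>
    refine lintegral_mono fun η => ?_
    dsimp only
    split_ifs
    · exact lintegral_mono fun ξ => hGG _ _ _
    · exact ih _ _

lemma epochValue_add (he : ∀ i, Measurable (e i))
    (hG : ∀ k i, Measurable (G k i)) (k i : ℕ) (hist : Fin i → Answer) (θ : ℝ) :
    epochValue σ e f (fun k i hist => G k i hist + G' k i hist) k i hist θ =
      epochValue σ e f G k i hist θ + epochValue σ e f G' k i hist θ := by
  induction k generalizing i with
  | zero => rfl
  | succ k ih =>
    simp only [epochValue]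
    rw [← lintegral_add_left]
    · refine lintegral_congr fun η => ?_
      split_ifs
      · exact lintegral_add_left ((measurable_noisyAnswer he hG k i).comp measurable_prodMk_left) _
      · exact ih _ _
    · exact Measurable.ite (measurableSet_lt (by fun_prop) measurable_const) measurable_const
        measurable_const

lemma epochValue_const_mul (he : ∀ i, Measurable (e i))
    (hG : ∀ k i, Measurable (G k i)) (c : ℝ≥0∞) (k i : ℕ) (hist : Fin i → Answer) (θ : ℝ) :
    epochValue σ e f (fun k i hist => c * G k i hist) k i hist θ =
      c * epochValue σ e f G k i hist θ := by
  induction k generalizing i with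
  | zero => rfl
  | succ k ih =>
    simp only [epochValue]
    rw [← lintegral_const_mul]
    · refine lintegral_congr fun η => ?_
      split_ifs
      · exact lintegral_const_mul _
          ((measurable_noisyAnswer he hG k i).comp measurable_prodMk_left)
      · exact ih _ _
    · exact Measurable.ite (measurableSet_lt (by fun_prop) measurable_const) measurable_const
        measurable_const

lemma epochValue_const (c : ℝ≥0∞) (k i : ℕ) (hist : Fin i → Answer) (θ : ℝ) :
    epochValue σ e f (fun _ _ _ => c) k i hist θ = c := by
  induction k generalizing i with
  | zero => rfl
  | succ k ih => simp [epochValue, ih]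

lemma epochStart_mono (hGG : ∀ k i hist, G k i hist ≤ G' k i hist) (k i : ℕ)
    (hist : Fin i → Answer) :
    epochStart σ T e f G k i hist ≤ epochStart σ T e f G' k i hist :=
  lintegral_mono fun _ => epochValue_mono hGG _ _ _ _

lemma epochStart_add (he : ∀ i, Measurable (e i)) (hf : ∀ i, Measurable (f i))
    (hG : ∀ k i, Measurable (G k i)) (k i : ℕ) (hist : Fin i → Answer) :
    epochStart σ T e f (fun k i hist => G k i hist + G' k i hist) k i hist =
      epochStart σ T e f G k i hist + epochStart σ T e f G' k i hist := by
  simp only [epochStart, epochValue_add he hG]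
  exact lintegral_add_left ((measurable_epochValue he hf hG k i).comp
    (measurable_const.prodMk (measurable_id.const_add T))) _

lemma epochStart_const_mul (he : ∀ i, Measurable (e i)) (hf : ∀ i, Measurable (f i))
    (hG : ∀ k i, Measurable (G k i)) (c : ℝ≥0∞) (k i : ℕ) (hist : Fin i → Answer) :
    epochStart σ T e f (fun k i hist => c * G k i hist) k i hist =
      c * epochStart σ T e f G k i hist := by
  simp only [epochStart, epochValue_const_mul he hG]
  exact lintegral_const_mul _ ((measurable_epochValue he hf hG k i).comp
    (measurable_const.prodMk (measurable_id.const_add T)))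

lemma epochStart_const (c : ℝ≥0∞) (k i : ℕ) (hist : Fin i → Answer) :
    epochStart σ T e f (fun _ _ _ => c) k i hist = c := by
  simp [epochStart, epochValue_const]

lemma epochStart_le_one (hG : ∀ k i hist, G k i hist ≤ 1) (k i : ℕ)
    (hist : Fin i → Answer) : epochStart σ T e f G k i hist ≤ 1 :=
  (epochStart_mono hG k i hist).trans (epochStart_const 1 k i hist).le

lemma budgetValue_le_one (hh : ∀ i hist, h i hist ≤ 1) (b k i : ℕ) (hist : Fin i → Answer) :
    budgetValue σ T e f h b k i hist ≤ 1 := by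
  induction b generalizing k i with
  | zero =>
    induction k generalizing i with
    | zero => exact hh _ _
    | succ k ih => exact ih _ _
  | succ b ih => exact epochStart_le_one (fun _ _ _ => ih _ _ _) _ _ _

lemma budgetValue_zero_right (b i : ℕ) (hist : Fin i → Answer) :
    budgetValue σ T e f h b 0 i hist = h i hist := by
  induction b generalizing i with
  | zero => rfl
  | succ b ih => simp [budgetValue, epochStart, epochValue, ih]

/-! ### Privacy of one epoch and composition -/

/-- The sparse vector argument: replacing the holdout means `e` by `e'` is compensated by raising
the noisy threshold by `d`. A query below the threshold stays below it, and for the query above it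
the noise `η` has to move by `2 d` and the noise `ξ` by `d`. -/
lemma epochValue_le_add (hσ : 0 < σ) (he' : ∀ i, Measurable (e' i))
    (hG : ∀ k i, Measurable (G k i)) (hd : ∀ i hist, |e i hist - e' i hist| ≤ d)
    (k i : ℕ) (hist : Fin i → Answer) (θ : ℝ) :
    epochValue σ e f G k i hist θ ≤ ENNReal.ofReal (Real.exp (d / σ + 2 * d / (4 * σ))) *
      epochValue σ e' f G k i hist (θ + d) := by
  have hd0 : 0 ≤ d := (abs_nonneg _).trans (hd i hist)
  have hK1 : 1 ≤ ENNReal.ofReal (Real.exp (d / σ + 2 * d / (4 * σ))) :=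
    ENNReal.one_le_ofReal.2 (Real.one_le_exp (by positivity))
  induction k generalizing i with
  | zero =>
    simp only [epochValue]
    exact le_mul_of_one_le_left zero_le hK1
  | succ k ih =>
    -- the integrals over `η` are combinations of the probabilities of the two branches
    have split : ∀ (u : ℝ) (v : ℝ) (a c : ℝ≥0∞),
        ∫⁻ η, (if v + η < u then a else c) ∂laplaceMeasure (4 * σ) =
          a * laplaceMeasure (4 * σ) (Set.Iio (u - v)) +
            c * laplaceMeasure (4 * σ) (Set.Ici (u - v)) := by
      intro u v a c
      rw [← lintegral_indicator_const measurableSet_Iio, ← lintegral_indicator_const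
        measurableSet_Ici, ← lintegral_add_left (measurable_const.indicator measurableSet_Iio)]
      refine lintegral_congr fun η => ?_
      by_cases hη : v + η < u
      · have h1 : η < u - v := by linarith
        simp only [hη, if_true, Set.indicator, Set.mem_Iio, Set.mem_Ici, not_le.2 h1, h1, if_false,
          add_zero]
      · have h1 : u - v ≤ η := by linarith
        simp only [hη, if_false, Set.indicator, Set.mem_Iio, Set.mem_Ici, not_lt.2 h1, h1, if_true,
          zero_add]
    simp only [epochValue]
    rw [split, split, mul_add]
    have hab : |e i hist - f i hist| ≤ |e' i hist - f i hist| + d := by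
      have := abs_sub_le (e i hist) (e' i hist) (f i hist)
      linarith [hd i hist]
    have hba : |e' i hist - f i hist| ≤ |e i hist - f i hist| + d := by
      have := abs_sub_le (e' i hist) (e i hist) (f i hist)
      rw [abs_sub_comm (e' i hist) (e i hist)] at this
      linarith [hd i hist]
    refine add_le_add ?_ ?_
    · have hξ : ∫⁻ ξ, G k (i + 1) (Fin.snoc hist (Sum.inl (e i hist + ξ))) ∂laplaceMeasure σ ≤
          ENNReal.ofReal (Real.exp (d / σ)) *
            ∫⁻ ξ, G k (i + 1) (Fin.snoc hist (Sum.inl (e' i hist + ξ))) ∂laplaceMeasure σ := by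
        have hm := (measurable_noisyAnswer he' hG k i).comp
          (measurable_prodMk_left (x := hist))
        refine le_trans (le_of_eq ?_) (lintegral_laplaceMeasure_add_le hσ (hd i hist) hm)
        refine lintegral_congr fun ξ => ?_
        congr 3
        ring
      have hη : laplaceMeasure (4 * σ) (Set.Iio (|e i hist - f i hist| - θ)) ≤
          ENNReal.ofReal (Real.exp (2 * d / (4 * σ))) *
            laplaceMeasure (4 * σ) (Set.Iio (|e' i hist - f i hist| - (θ + d))) := by
        have := lintegral_laplaceMeasure_add_le (b := 4 * σ) (by positivity) (c := -(2 * d))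
          (r := 2 * d) (by rw [abs_neg, abs_of_nonneg (by positivity)])
          (h := (Set.Iio (|e' i hist - f i hist| - (θ + d))).indicator 1)
          (measurable_one.indicator measurableSet_Iio)
        rw [lintegral_indicator_one measurableSet_Iio] at this
        refine le_trans ?_ this
        rw [← lintegral_indicator_one measurableSet_Iio]
        refine lintegral_mono fun x => ?_
        by_cases hx : x < |e i hist - f i hist| - θ
        · have h2 : x + -(2 * d) < |e' i hist - f i hist| - (θ + d) := by linarith
          rw [Set.indicator_of_mem (by exact hx), Set.indicator_of_mem (by exact h2)]
          simp
        · simp [hx]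
      rw [Real.exp_add, ENNReal.ofReal_mul (Real.exp_pos _).le]
      calc _ ≤ _ := mul_le_mul' hξ hη
        _ = _ := by ring
    · rw [← mul_assoc]
      refine mul_le_mul' (ih _ _) (measure_mono (Set.Ici_subset_Ici.2 ?_))
      linarith

/-- One epoch is `2 d / σ`-differentially private. -/
lemma epochStart_le (hσ : 0 < σ) (he' : ∀ i, Measurable (e' i)) (hf : ∀ i, Measurable (f i))
    (hG : ∀ k i, Measurable (G k i)) (hd : ∀ i hist, |e i hist - e' i hist| ≤ d)
    (k i : ℕ) (hist : Fin i → Answer) :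
    epochStart σ T e f G k i hist ≤
      ENNReal.ofReal (Real.exp (2 * d / σ)) * epochStart σ T e' f G k i hist := by
  have hd0 : 0 ≤ d := (abs_nonneg _).trans (hd i hist)
  have hm : Measurable fun γ => epochValue σ e' f G k i hist (T + γ) :=
    (measurable_epochValue he' hf hG k i).comp
      (measurable_const.prodMk (measurable_id.const_add T))
  have h1 := lintegral_laplaceMeasure_add_le (b := 2 * σ) (by positivity)
    (abs_of_nonneg hd0).le hm
  calc epochStart σ T e f G k i hist
      ≤ ∫⁻ γ, ENNReal.ofReal (Real.exp (d / σ + 2 * d / (4 * σ))) *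
          epochValue σ e' f G k i hist (T + (γ + d)) ∂laplaceMeasure (2 * σ) := by
        refine lintegral_mono fun γ => ?_
        rw [← add_assoc]
        exact epochValue_le_add hσ he' hG hd k i hist (T + γ)
    _ = ENNReal.ofReal (Real.exp (d / σ + 2 * d / (4 * σ))) *
          ∫⁻ γ, epochValue σ e' f G k i hist (T + (γ + d)) ∂laplaceMeasure (2 * σ) :=
        lintegral_const_mul _ (hm.comp (measurable_id.add_const d))
    _ ≤ ENNReal.ofReal (Real.exp (d / σ + 2 * d / (4 * σ))) *
          (ENNReal.ofReal (Real.exp (d / (2 * σ))) * epochStart σ T e' f G k i hist) := by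
        gcongr
        exact h1
    _ = _ := by
        rw [← mul_assoc, ← ENNReal.ofReal_mul (Real.exp_pos _).le, ← Real.exp_add]
        congr 3
        field_simp
        ring

/-- Pure differential privacy of Thresholdout: the privacy losses of the epochs add up. -/
lemma budgetValue_le (hσ : 0 < σ) (he : ∀ i, Measurable (e i)) (he' : ∀ i, Measurable (e' i))
    (hf : ∀ i, Measurable (f i)) (hh : ∀ i, Measurable (h i))
    (hd : ∀ i hist, |e i hist - e' i hist| ≤ d) (b k i : ℕ) (hist : Fin i → Answer) :
    budgetValue σ T e f h b k i hist ≤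
      ENNReal.ofReal (Real.exp (2 * d / σ)) ^ b * budgetValue σ T e' f h b k i hist := by
  induction b generalizing k i with
  | zero => simp [budgetValue]
  | succ b ih =>
    have hm' := measurable_budgetValue (σ := σ) (T := T) he' hf hh b
    calc budgetValue σ T e f h (b + 1) k i hist
        ≤ ENNReal.ofReal (Real.exp (2 * d / σ)) *
            epochStart σ T e' f (budgetValue σ T e f h b) k i hist :=
          epochStart_le hσ he' hf (measurable_budgetValue he hf hh b) hd k i hist
      _ ≤ ENNReal.ofReal (Real.exp (2 * d / σ)) * epochStart σ T e' f (fun k i hist =>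
            ENNReal.ofReal (Real.exp (2 * d / σ)) ^ b * budgetValue σ T e' f h b k i hist)
            k i hist := by
          gcongr
          exact epochStart_mono (fun _ _ _ => ih _ _ _) _ _ _
      _ = _ := by
          rw [epochStart_const_mul he' hf hm', ← mul_assoc, pow_succ']
          rfl

end Values
end Thresholdout

/-! ### From pure privacy of an epoch to a Hölder-type bound -/

lemma Real.rpow_le_tangent {p a x : ℝ} (hp : 0 < p) (hp1 : p < 1) (ha : 0 < a) (hx : 0 ≤ x) :
    x ^ p ≤ p * a ^ (p - 1) * x + (1 - p) * a ^ p := by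
  have h := Real.geom_mean_le_arith_mean2_weighted hp.le (by linarith : 0 ≤ 1 - p) hx ha.le
    (by ring)
  have h2 : a ^ (1 - p) * a ^ (p - 1) = 1 := by
    rw [← Real.rpow_add ha]; simp
  have h3 : a * a ^ (p - 1) = a ^ p := by
    rw [Real.rpow_sub_one ha.ne']; field_simp
  calc x ^ p = x ^ p * a ^ (1 - p) * a ^ (p - 1) := by rw [mul_assoc, h2, mul_one]
    _ ≤ (p * x + (1 - p) * a) * a ^ (p - 1) := by gcongr
    _ = p * a ^ (p - 1) * x + (1 - p) * (a * a ^ (p - 1)) := by ring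
    _ = _ := by rw [h3]

lemma exp_add_exp_le_cosh {α ε : ℝ} (hα : 1 ≤ α) :
    Real.exp (α * ε) + Real.exp (-((α - 1) * ε)) ≤
      (Real.exp ε + 1) * Real.exp (α ^ 2 * ε ^ 2 / 2) := by
  have h1 : Real.exp (α * ε) + Real.exp (-((α - 1) * ε)) =
      Real.exp (ε / 2) * (2 * Real.cosh ((α - 1 / 2) * ε)) := by
    rw [Real.cosh_eq, mul_div_cancel₀ _ (two_ne_zero), mul_add, ← Real.exp_add, ← Real.exp_add]
    congr 2 <;> ring
  have h2 : Real.cosh ((α - 1 / 2) * ε) ≤ Real.exp (α ^ 2 * ε ^ 2 / 2) := by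
    refine (Real.cosh_le_exp_half_sq _).trans (Real.exp_le_exp.2 ?_)
    rw [mul_pow]
    gcongr <;> linarith
  have h3 : 2 * Real.exp (ε / 2) ≤ Real.exp ε + 1 := by
    have : Real.exp ε = Real.exp (ε / 2) ^ 2 := by rw [← Real.exp_nat_mul]; congr 1; push_cast; ring
    nlinarith [sq_nonneg (Real.exp (ε / 2) - 1)]
  calc _ = 2 * Real.exp (ε / 2) * Real.cosh ((α - 1 / 2) * ε) := by rw [h1]; ring
    _ ≤ _ := mul_le_mul h3 h2 (Real.cosh_pos _).le (by positivity)

/-- The numerical core of the Hölder bound. For positive normalized functionals `Λ`, `Λ'` with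
`Λ ≤ exp ε • Λ'` and `Λ' ≤ exp ε • Λ`, put `x = Λ (F ^ p)`, `x' = Λ' (F ^ p)`, `y = Λ F` and
`y' = Λ' F`. The hypotheses say that `exp ε • Λ - Λ'` and `exp ε • Λ' - Λ` are nonnegative on
the difference of `F ^ p` and its tangent at any `a > 0`. -/
lemma le_exp_mul_rpow_of_tangent {α ε p x x' y y' : ℝ} (hα : 1 < α) (hε : 0 < ε)
    (hp : p = 1 - α⁻¹) (hy' : 0 ≤ y')
    (h1 : ∀ a : ℝ, 0 < a → p * a ^ (p - 1) * y' + (1 - p) * a ^ p - x' ≤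
      Real.exp ε * (p * a ^ (p - 1) * y + (1 - p) * a ^ p - x))
    (h2 : ∀ a : ℝ, 0 < a → p * a ^ (p - 1) * y + (1 - p) * a ^ p - x ≤
      Real.exp ε * (p * a ^ (p - 1) * y' + (1 - p) * a ^ p - x')) :
    x ≤ Real.exp (α * ε ^ 2 / 2) * y' ^ p := by
  have hα0 : 0 < α := by linarith
  have hpα : p * α = α - 1 := by rw [hp]; field_simp
  have hp0 : 0 < p := by rw [hp]; have := inv_lt_one_of_one_lt₀ hα; linarith
  have h1p : 1 - p = α⁻¹ := by rw [hp]; ring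
  have h1p0 : 0 < 1 - p := by rw [h1p]; positivity
  set K := Real.exp (α ^ 2 * ε ^ 2 / 2) with hK
  have hK0 : 0 < K := Real.exp_pos _
  have hE : 1 < Real.exp ε := Real.one_lt_exp_iff.2 hε
  -- the tangents at `s exp (α ε)` and `s exp (-α ε)` combine into a bound by `y'` alone
  have main : ∀ s : ℝ, 0 < s → x ≤ p * s ^ (p - 1) * y' + (1 - p) * s ^ p * K := by
    intro s hs
    have ea : ∀ r : ℝ, (s * Real.exp (r * ε)) ^ (p - 1) = s ^ (p - 1) * Real.exp ((p - 1) * r * ε) := by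
      intro r
      rw [Real.mul_rpow hs.le (Real.exp_pos _).le, ← Real.exp_mul]
      congr 2; ring
    have eb : ∀ r : ℝ, (s * Real.exp (r * ε)) ^ p = s ^ p * Real.exp (p * r * ε) := by
      intro r
      rw [Real.mul_rpow hs.le (Real.exp_pos _).le, ← Real.exp_mul]
      congr 2; ring
    have A := h1 (s * Real.exp (α * ε)) (by positivity)
    have B := h2 (s * Real.exp (-α * ε)) (by positivity)
    rw [ea, eb] at A B
    have e1 : (p - 1) * α * ε = -ε := by
      have : (p - 1) * α = -1 := by rw [sub_mul, hpα]; ring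
      rw [this]; ring
    have e2 : (p - 1) * -α * ε = ε := by linarith
    have e3 : p * α * ε = α * ε - ε := by rw [hpα]; ring
    have e4 : p * -α * ε = -((α - 1) * ε) := by rw [mul_neg, hpα]; ring
    rw [e1, e3, Real.exp_neg, Real.exp_sub] at A
    rw [e2, e4] at B
    have hcosh := exp_add_exp_le_cosh (ε := ε) hα.le
    rw [← hK] at hcosh
    set E := Real.exp ε
    set U := Real.exp (α * ε)
    set V := Real.exp (-((α - 1) * ε))
    have hE0 : 0 < E := by linarith
    have hfin : (E ^ 2 - 1) * x ≤ (E ^ 2 - 1) * (p * s ^ (p - 1) * y') +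
        (1 - p) * s ^ p * ((E - 1) * (U + V)) := by
      have A' := mul_le_mul_of_nonneg_left A hE0.le
      have a1 : E * (p * (s ^ (p - 1) * E⁻¹) * y' + (1 - p) * (s ^ p * (U / E)) - x') =
          p * s ^ (p - 1) * y' + (1 - p) * s ^ p * U - E * x' := by field_simp
      have a2 : E * (E * (p * (s ^ (p - 1) * E⁻¹) * y + (1 - p) * (s ^ p * (U / E)) - x)) =
          E * (p * s ^ (p - 1) * y) + E * ((1 - p) * s ^ p * U) - E ^ 2 * x := by field_simp
      rw [a1, a2] at A'
      nlinarith [A', B]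
    have hfin2 : (1 - p) * s ^ p * ((E - 1) * (U + V)) ≤
        (1 - p) * s ^ p * ((E - 1) * ((E + 1) * K)) := by
      have : 0 ≤ E - 1 := by linarith
      gcongr
    have hpos : 0 < E ^ 2 - 1 := by nlinarith
    refine le_of_mul_le_mul_left ?_ hpos
    calc _ ≤ _ := hfin.trans (add_le_add_right hfin2 _)
      _ = _ := by ring
  have hKp : Real.exp (α * ε ^ 2 / 2) = K ^ (1 - p) := by
    rw [hK, ← Real.exp_mul, h1p]
    congr 1
    field_simp
  rcases hy'.eq_or_lt with h0 | h0
  · -- for `y' = 0` let `s` tend to `0`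
    rw [← h0, Real.zero_rpow hp0.ne', mul_zero]
    refine le_of_forall_pos_le_add fun δ hδ => ?_
    have hb : 0 < δ / ((1 - p) * K) := by positivity
    have := main ((δ / ((1 - p) * K)) ^ (p⁻¹)) (by positivity)
    rw [← h0, mul_zero, zero_add, ← Real.rpow_mul hb.le, inv_mul_cancel₀ hp0.ne', Real.rpow_one]
      at this
    refine this.trans (le_of_eq ?_)
    field_simp
    ring
  · have := main (y' / K) (by positivity)
    refine this.trans (le_of_eq ?_)
    rw [hKp, Real.div_rpow h0.le hK0.le, Real.div_rpow h0.le hK0.le, Real.rpow_sub_one h0.ne',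
      Real.rpow_sub_one hK0.ne', Real.rpow_sub hK0, Real.rpow_one]
    field_simp
    ring

namespace Thresholdout

variable {σ T d : ℝ} {e e' f : (i : ℕ) → (Fin i → Answer) → ℝ}
  {G : ℕ → (i : ℕ) → (Fin i → Answer) → ℝ≥0∞} {h : (i : ℕ) → (Fin i → Answer) → ℝ≥0∞}

/-- Concentrated privacy of one epoch: its privacy loss enters quadratically. -/
lemma epochStart_rpow_le (hσ : 0 < σ) (he : ∀ i, Measurable (e i)) (he' : ∀ i, Measurable (e' i))
    (hf : ∀ i, Measurable (f i)) (hG : ∀ k i, Measurable (G k i))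
    (hG1 : ∀ k i hist, G k i hist ≤ 1) (hd0 : 0 < d)
    (hd : ∀ i hist, |e i hist - e' i hist| ≤ d) {α : ℝ} (hα : 1 < α)
    (k i : ℕ) (hist : Fin i → Answer) :
    epochStart σ T e f (fun k i hist => G k i hist ^ (1 - α⁻¹)) k i hist ≤
      ENNReal.ofReal (Real.exp (α * (2 * d / σ) ^ 2 / 2)) *
        epochStart σ T e' f G k i hist ^ (1 - α⁻¹) := by
  set p := 1 - α⁻¹ with hp
  have hp0 : 0 < p := by have := inv_lt_one_of_one_lt₀ hα; linarith
  have hp1 : p < 1 := by have : 0 < α⁻¹ := by positivity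
                         linarith
  have hd' : ∀ i hist, |e' i hist - e i hist| ≤ d := fun i hist => by
    rw [abs_sub_comm]; exact hd i hist
  have hFp1 : ∀ k i hist, G k i hist ^ p ≤ 1 := fun k i hist => by
    exact ENNReal.rpow_le_one (hG1 _ _ _) hp0.le
  have hFpm : ∀ k i, Measurable fun hist : Fin i → Answer => G k i hist ^ p :=
    fun k i => (hG k i).pow_const p
  have htop : ∀ {e : (i : ℕ) → (Fin i → Answer) → ℝ}
      {G : ℕ → (i : ℕ) → (Fin i → Answer) → ℝ≥0∞}, (∀ k i hist, G k i hist ≤ 1) →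
      epochStart σ T e f G k i hist ≠ ⊤ := fun hG1 =>
    ((epochStart_le_one hG1 k i hist).trans_lt ENNReal.one_lt_top).ne
  -- the difference of `G ^ p` and its tangent at `a`
  let D : ℝ → ℕ → (i : ℕ) → (Fin i → Answer) → ℝ≥0∞ := fun a k i hist =>
    ENNReal.ofReal (p * a ^ (p - 1) * (G k i hist).toReal + (1 - p) * a ^ p -
      (G k i hist).toReal ^ p)
  have hDm : ∀ a k i, Measurable (D a k i) := fun a k i => by
    have := (hG k i).ennreal_toReal
    exact ((((this.const_mul _).add_const _).sub (this.pow_const p))).ennreal_ofReal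
  have hD : ∀ (a : ℝ), 0 < a → ∀ (e : (i : ℕ) → (Fin i → Answer) → ℝ),
      (∀ i, Measurable (e i)) → epochStart σ T e f (D a) k i hist ≠ ⊤ ∧
      (epochStart σ T e f (D a) k i hist).toReal =
        p * a ^ (p - 1) * (epochStart σ T e f G k i hist).toReal + (1 - p) * a ^ p -
          (epochStart σ T e f (fun k i hist => G k i hist ^ p) k i hist).toReal := by
    intro a ha e he
    have hc1 : 0 ≤ p * a ^ (p - 1) := by positivity
    have hc2 : 0 ≤ (1 - p) * a ^ p := mul_nonneg (by linarith) (by positivity)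
    have hsum : (fun (k i : ℕ) (hist : Fin i → Answer) => G k i hist ^ p + D a k i hist) =
        fun k i hist => ENNReal.ofReal (p * a ^ (p - 1)) * G k i hist +
          ENNReal.ofReal ((1 - p) * a ^ p) := by
      funext k i hist
      have hGt : G k i hist ≠ ⊤ := ((hG1 k i hist).trans_lt ENNReal.one_lt_top).ne
      obtain ⟨g, hg⟩ : ∃ g : ℝ, 0 ≤ g ∧ G k i hist = ENNReal.ofReal g :=
        ⟨_, ENNReal.toReal_nonneg, (ENNReal.ofReal_toReal hGt).symm⟩
      simp only [D, hg.2, ENNReal.toReal_ofReal hg.1]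
      have ht := Real.rpow_le_tangent hp0 hp1 ha hg.1
      rw [ENNReal.ofReal_rpow_of_nonneg hg.1 hp0.le, ← ENNReal.ofReal_add
        (Real.rpow_nonneg hg.1 _) (by linarith), ← ENNReal.ofReal_mul hc1,
        ← ENNReal.ofReal_add (mul_nonneg hc1 hg.1) hc2]
      congr 1
      ring
    have h1 := epochStart_add (σ := σ) (T := T) (G' := D a) he hf hFpm k i hist
    rw [hsum, epochStart_add he hf (fun k i => (hG k i).const_mul _),
      epochStart_const_mul he hf hG, epochStart_const] at h1
    have h2 := congrArg ENNReal.toReal h1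
    have hDt : epochStart σ T e f (D a) k i hist ≠ ⊤ := by
      intro ht
      rw [ht, add_top] at h1
      exact ENNReal.add_ne_top.2 ⟨ENNReal.mul_ne_top ENNReal.ofReal_ne_top (htop hG1),
        ENNReal.ofReal_ne_top⟩ h1
    rw [ENNReal.toReal_add (ENNReal.mul_ne_top ENNReal.ofReal_ne_top (htop hG1))
      ENNReal.ofReal_ne_top, ENNReal.toReal_mul, ENNReal.toReal_ofReal hc1,
      ENNReal.toReal_ofReal hc2, ENNReal.toReal_add (htop hFp1) hDt] at h2
    exact ⟨hDt, by linarith⟩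
  have hcomp : ∀ (a : ℝ), 0 < a → ∀ (e e' : (i : ℕ) → (Fin i → Answer) → ℝ),
      (∀ i, Measurable (e i)) → (∀ i, Measurable (e' i)) →
      (∀ i hist, |e i hist - e' i hist| ≤ d) →
      p * a ^ (p - 1) * (epochStart σ T e f G k i hist).toReal + (1 - p) * a ^ p -
          (epochStart σ T e f (fun k i hist => G k i hist ^ p) k i hist).toReal ≤
      Real.exp (2 * d / σ) * (p * a ^ (p - 1) * (epochStart σ T e' f G k i hist).toReal +
        (1 - p) * a ^ p -
          (epochStart σ T e' f (fun k i hist => G k i hist ^ p) k i hist).toReal) := by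
    intro a ha e e' he he' hd
    have h1 := epochStart_le (T := T) hσ he' hf (hDm a) hd k i hist
    have h2 := ENNReal.toReal_mono
      (ENNReal.mul_ne_top ENNReal.ofReal_ne_top (hD a ha e' he').1) h1
    rwa [ENNReal.toReal_mul, ENNReal.toReal_ofReal (Real.exp_pos _).le, (hD a ha e he).2,
      (hD a ha e' he').2] at h2
  have := le_exp_mul_rpow_of_tangent hα (ε := 2 * d / σ) (by positivity) hp
    (ENNReal.toReal_nonneg (a := epochStart σ T e' f G k i hist))
    (fun a ha => hcomp a ha e' e he' he hd') (fun a ha => hcomp a ha e e' he he' hd)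
  rw [← ENNReal.ofReal_toReal (htop (e := e) hFp1), ← ENNReal.ofReal_toReal (htop (e := e') hG1),
    ENNReal.ofReal_rpow_of_nonneg ENNReal.toReal_nonneg hp0.le,
    ← ENNReal.ofReal_mul (Real.exp_pos _).le]
  exact ENNReal.ofReal_le_ofReal this

/-- Concentrated privacy of Thresholdout: the squared privacy losses of the epochs add up. -/
lemma budgetValue_le_rpow (hσ : 0 < σ) (he : ∀ i, Measurable (e i))
    (he' : ∀ i, Measurable (e' i)) (hf : ∀ i, Measurable (f i)) (hh : ∀ i, Measurable (h i))
    (hh1 : ∀ i hist, h i hist ≤ 1) (hd0 : 0 < d)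
    (hd : ∀ i hist, |e i hist - e' i hist| ≤ d) {α : ℝ} (hα : 1 < α)
    (b k i : ℕ) (hist : Fin i → Answer) :
    budgetValue σ T e f h b k i hist ≤
      ENNReal.ofReal (Real.exp (α * (2 * d / σ) ^ 2 / 2)) ^ b *
        budgetValue σ T e' f h b k i hist ^ (1 - α⁻¹) := by
  have hα0 : 0 < α⁻¹ := by positivity
  have hα1 : α⁻¹ < 1 := inv_lt_one_of_one_lt₀ hα
  induction b generalizing k i with
  | zero =>
    rw [pow_zero, one_mul]
    have h1 : budgetValue σ T e f h 0 k i hist = budgetValue σ T e' f h 0 k i hist := rfl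
    rw [h1]
    simpa using ENNReal.rpow_le_rpow_of_exponent_ge
      (budgetValue_le_one (σ := σ) (T := T) (e := e') (f := f) hh1 0 k i hist)
      (show 1 - α⁻¹ ≤ 1 by linarith)
  | succ b ih =>
    have hm' := measurable_budgetValue (σ := σ) (T := T) he' hf hh b
    calc budgetValue σ T e f h (b + 1) k i hist
        ≤ epochStart σ T e f (fun k i hist =>
            ENNReal.ofReal (Real.exp (α * (2 * d / σ) ^ 2 / 2)) ^ b *
              budgetValue σ T e' f h b k i hist ^ (1 - α⁻¹)) k i hist :=
          epochStart_mono (fun _ _ _ => ih _ _ _) _ _ _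
      _ = ENNReal.ofReal (Real.exp (α * (2 * d / σ) ^ 2 / 2)) ^ b *
            epochStart σ T e f (fun k i hist =>
              budgetValue σ T e' f h b k i hist ^ (1 - α⁻¹)) k i hist :=
          epochStart_const_mul he hf (fun k i => (hm' k i).pow_const _) _ _ _ _
      _ ≤ ENNReal.ofReal (Real.exp (α * (2 * d / σ) ^ 2 / 2)) ^ b *
            (ENNReal.ofReal (Real.exp (α * (2 * d / σ) ^ 2 / 2)) *
              epochStart σ T e' f (budgetValue σ T e' f h b) k i hist ^ (1 - α⁻¹)) := by
          gcongr
          exact epochStart_rpow_le hσ he he' hf hm' (budgetValue_le_one hh1 b) hd0 hd hα k i hist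
      _ = _ := by
          rw [← mul_assoc, ← pow_succ]
          rfl

/-- A linear form of `budgetValue_le_rpow`, obtained from Young's inequality with the parameter
`s`. -/
lemma budgetValue_le_linear (hσ : 0 < σ) (he : ∀ i, Measurable (e i))
    (he' : ∀ i, Measurable (e' i)) (hf : ∀ i, Measurable (f i)) (hh : ∀ i, Measurable (h i))
    (hh1 : ∀ i hist, h i hist ≤ 1) (hd0 : 0 < d)
    (hd : ∀ i hist, |e i hist - e' i hist| ≤ d) {α s : ℝ} (hα : 1 < α) (hs : 0 < s)
    (b k i : ℕ) (hist : Fin i → Answer) :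
    budgetValue σ T e f h b k i hist ≤
      ENNReal.ofReal (Real.exp (b * (α * (2 * d / σ) ^ 2 / 2)) * s ^ (-α⁻¹)) *
        budgetValue σ T e' f h b k i hist +
      ENNReal.ofReal (Real.exp (b * (α * (2 * d / σ) ^ 2 / 2)) * s ^ (-α⁻¹) * (s / α)) := by
  have hα0 : 0 < α⁻¹ := by positivity
  have hα1 : α⁻¹ < 1 := inv_lt_one_of_one_lt₀ hα
  refine (budgetValue_le_rpow hσ he he' hf hh hh1 hd0 hd hα b k i hist).trans ?_
  have ht : budgetValue σ T e' f h b k i hist ≠ ⊤ :=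
    ((budgetValue_le_one hh1 b k i hist).trans_lt ENNReal.one_lt_top).ne
  obtain ⟨g, hg⟩ : ∃ g : ℝ, 0 ≤ g ∧ budgetValue σ T e' f h b k i hist = ENNReal.ofReal g :=
    ⟨_, ENNReal.toReal_nonneg, (ENNReal.ofReal_toReal ht).symm⟩
  rw [hg.2, ENNReal.ofReal_rpow_of_nonneg hg.1 (by linarith),
    ← ENNReal.ofReal_pow (Real.exp_pos _).le, ← Real.exp_nat_mul, ← ENNReal.ofReal_mul
    (Real.exp_pos _).le, ← ENNReal.ofReal_mul (by positivity), ← ENNReal.ofReal_add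
    (mul_nonneg (by positivity) hg.1) (by positivity)]
  apply ENNReal.ofReal_le_ofReal
  have h1 := Real.rpow_le_tangent (p := 1 - α⁻¹) (by linarith) (by linarith) hs hg.1
  have h2 : s ^ (1 - α⁻¹) = s ^ (-α⁻¹) * s := by
    rw [sub_eq_neg_add, Real.rpow_add hs, Real.rpow_one]
  have h3 : (1 - α⁻¹ - 1 : ℝ) = -α⁻¹ := by ring
  rw [h3, h2] at h1
  have h4 : (1 - α⁻¹) * s ^ (-α⁻¹) * g ≤ s ^ (-α⁻¹) * g := by
    have : 0 ≤ s ^ (-α⁻¹) * g := mul_nonneg (by positivity) hg.1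
    nlinarith
  calc Real.exp (b * (α * (2 * d / σ) ^ 2 / 2)) * g ^ (1 - α⁻¹)
      ≤ Real.exp (b * (α * (2 * d / σ) ^ 2 / 2)) *
          (s ^ (-α⁻¹) * g + (1 - (1 - α⁻¹)) * (s ^ (-α⁻¹) * s)) := by
        gcongr
        linarith
    _ = _ := by
        rw [div_eq_mul_inv]
        ring

end Thresholdout

/-! ### Resampling one coordinate -/

lemma MeasureTheory.lintegral_pi_update {ι X : Type*} [Fintype ι] [DecidableEq ι]
    [MeasurableSpace X] (P : ι → Measure X) [∀ i, IsProbabilityMeasure (P i)] (i : ι)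
    {g : (ι → X) → ℝ≥0∞} (hg : Measurable g) :
    ∫⁻ S, ∫⁻ x, g (Function.update S i x) ∂P i ∂Measure.pi P = ∫⁻ S, g S ∂Measure.pi P := by
  rcases isEmpty_or_nonempty (ι → X) with hX | ⟨⟨S₀⟩⟩
  · simp [lintegral_of_isEmpty]
  have hg' : Measurable fun S => ∫⁻ x, g (Function.update S i x) ∂P i :=
    Measurable.lintegral_prod_right' (f := fun q : (ι → X) × X => g (Function.update q.1 i q.2))
      (hg.comp (by fun_prop))
  rw [lintegral_eq_lmarginal_univ S₀, lintegral_eq_lmarginal_univ S₀,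
    lmarginal_erase' g hg (Finset.mem_univ i), lmarginal_erase' _ hg' (Finset.mem_univ i)]
  simp

/-- Exchanging the `i`-th point of a sample with an independent further point of the same law does
not change the joint law. -/
lemma MeasureTheory.lintegral_pi_swap {ι X : Type*} [Fintype ι] [DecidableEq ι]
    [MeasurableSpace X] (P : ι → Measure X) [∀ i, IsProbabilityMeasure (P i)] (i : ι)
    {g : (ι → X) × X → ℝ≥0∞} (hg : Measurable g) :
    ∫⁻ S, ∫⁻ x, g (Function.update S i x, S i) ∂P i ∂Measure.pi P =
      ∫⁻ S, ∫⁻ x, g (S, x) ∂P i ∂Measure.pi P := by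
  have h1 : Measurable fun S : ι → X => ∫⁻ x, g (Function.update S i x, S i) ∂P i :=
    Measurable.lintegral_prod_right'
      (f := fun q : (ι → X) × X => g (Function.update q.1 i q.2, q.1 i)) (hg.comp (by fun_prop))
  rw [← lintegral_pi_update P i h1, ← lintegral_pi_update P i hg.lintegral_prod_right']
  refine lintegral_congr fun S => ?_
  simp only [Function.update_idem, Function.update_self]
  exact lintegral_lintegral_swap (f := fun a b => g (Function.update S i b, a))
    (hg.comp (by fun_prop)).aemeasurable

/-! ### Generalization of the output of a private mechanism -/

lemma one_sub_add_mul_exp_le {t : ℝ} (ht : t ∈ Set.Icc (0 : ℝ) 1) (s : ℝ) :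
    1 - t + t * Real.exp s ≤ Real.exp (t * s + s ^ 2 / 8) := by
  -- Hoeffding's lemma for the Bernoulli distribution
  let ρ : Measure ℝ := ENNReal.ofReal (1 - t) • Measure.dirac 0 + ENNReal.ofReal t • Measure.dirac 1
  have h0 : 0 ≤ 1 - t := by linarith [ht.2]
  have hρ : IsProbabilityMeasure ρ := ⟨by
    simp only [ρ, Measure.coe_add, Measure.coe_smul, Pi.add_apply, Pi.smul_apply, measure_univ,
      smul_eq_mul, mul_one]
    rw [← ENNReal.ofReal_add h0 ht.1]
    simp⟩
  have hint : ∀ g : ℝ → ℝ, ∫ x, g x ∂ρ = (1 - t) * g 0 + t * g 1 := by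
    intro g
    have hi : ∀ x : ℝ, Integrable g (Measure.dirac x) := fun x => by
      exact integrable_dirac (by simp)
    rw [integral_add_measure ((hi 0).smul_measure ENNReal.ofReal_ne_top)
      ((hi 1).smul_measure ENNReal.ofReal_ne_top), integral_smul_measure, integral_smul_measure,
      integral_dirac, integral_dirac, ENNReal.toReal_ofReal h0, ENNReal.toReal_ofReal ht.1]
    rfl
  have hmem : ∀ᵐ x ∂ρ, x ∈ Set.Icc (0 : ℝ) 1 := by
    simp only [ρ, ae_add_measure_iff]
    exact ⟨Measure.ae_smul_measure (by simp [ae_dirac_eq]) _,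
      Measure.ae_smul_measure (by simp [ae_dirac_eq]) _⟩
  have h := (ProbabilityTheory.hasSubgaussianMGF_of_mem_Icc (X := fun x : ℝ => x) (μ := ρ)
    aemeasurable_id hmem).mgf_le s
  rw [ProbabilityTheory.mgf, hint, hint] at h
  simp only [mul_zero, mul_one, zero_add, zero_sub, sub_zero] at h
  have h2 : (((‖(1 : ℝ)‖₊ / 2) ^ 2 : NNReal) : ℝ) * s ^ 2 / 2 = s ^ 2 / 8 := by
    push_cast
    norm_num
    ring
  rw [h2] at h
  calc 1 - t + t * Real.exp s
      = Real.exp (t * s) * ((1 - t) * Real.exp (s * -t) + t * Real.exp (s * (1 - t))) := by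
        have e0 : Real.exp (t * s) * Real.exp (s * -t) = 1 := by
          rw [← Real.exp_add, mul_neg, mul_comm, add_neg_cancel, Real.exp_zero]
        have e1 : Real.exp (t * s) * Real.exp (s * (1 - t)) = Real.exp s := by
          rw [← Real.exp_add]; congr 1; ring
        rw [mul_add, mul_left_comm, mul_left_comm (Real.exp (t * s)), e0, e1, mul_one]
    _ ≤ Real.exp (t * s) * Real.exp (s ^ 2 / 8) := by gcongr
    _ = _ := by rw [← Real.exp_add]

section Generalization

open ProbabilityTheory

variable {X Y : Type*} [MeasurableSpace X] [MeasurableSpace Y] {P : Measure X}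
  [IsProbabilityMeasure P] {n : ℕ} {K : Kernel (Fin n → X) Y} [IsMarkovKernel K]
  {φ : Y → X → ℝ}

lemma integral_mem_Icc {g : X → ℝ} (hg : ∀ x, g x ∈ Set.Icc (0 : ℝ) 1) :
    ∫ x, g x ∂P ∈ Set.Icc (0 : ℝ) 1 := by
  refine ⟨integral_nonneg fun x => (hg x).1, ?_⟩
  by_cases hi : Integrable g P
  · simpa using integral_mono hi (integrable_const (1 : ℝ)) fun x => (hg x).2
  · rw [integral_undef hi]; exact zero_le_one

lemma integrable_of_mem_Icc {g : X → ℝ} (hm : Measurable g) (hg : ∀ x, g x ∈ Set.Icc (0 : ℝ) 1) :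
    Integrable g P :=
  Integrable.of_bound hm.aestronglyMeasurable 1 (Filter.Eventually.of_forall fun x => by
    rw [Real.norm_eq_abs, abs_of_nonneg (hg x).1]; exact (hg x).2)

lemma measurable_integral_query (hφ : Measurable (Function.uncurry φ)) :
    Measurable fun y => ∫ x, φ y x ∂P :=
  (hφ.stronglyMeasurable.integral_prod_right (ν := P)).measurable

/-- Averaging the query over a point that is independent of the mechanism. -/
lemma lintegral_fresh_point (hφ : Measurable (Function.uncurry φ))
    (h01 : ∀ y x, φ y x ∈ Set.Icc (0 : ℝ) 1) {v : (Fin n → X) × Y → ℝ≥0∞} (hv : Measurable v)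
    (S : Fin n → X) :
    ∫⁻ x', ∫⁻ y, ENNReal.ofReal (φ y x') * v (S, y) ∂K S ∂P =
      ∫⁻ y, ENNReal.ofReal (∫ x, φ y x ∂P) * v (S, y) ∂K S := by
  have hm : Measurable fun q : X × Y => ENNReal.ofReal (φ q.2 q.1) :=
    (hφ.comp measurable_swap).ennreal_ofReal
  rw [lintegral_lintegral_swap (f := fun x' y => ENNReal.ofReal (φ y x') * v (S, y))
    (hm.mul (hv.comp (measurable_const.prodMk measurable_snd))).aemeasurable]
  refine lintegral_congr fun y => ?_
  rw [lintegral_mul_const (f := fun x => ENNReal.ofReal (φ y x)) _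
    (hm.comp measurable_prodMk_right), ofReal_integral_eq_lintegral_ofReal (f := fun x => φ y x)
    (integrable_of_mem_Icc (hφ.comp measurable_prodMk_left) (h01 y))
    (Filter.Eventually.of_forall fun x => (h01 y x).1)]

lemma lintegral_kernel_update (i : Fin n) {F : ((Fin n → X) × X) × Y → ℝ≥0∞} (hF : Measurable F) :
    ∫⁻ S, ∫⁻ x', ∫⁻ y, F ((S, x'), y) ∂K (Function.update S i x') ∂P ∂Measure.pi (fun _ => P) =
      ∫⁻ S, ∫⁻ x', ∫⁻ y, F ((Function.update S i x', S i), y) ∂K S ∂P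
        ∂Measure.pi (fun _ => P) := by
  have hu : Measurable fun q : (Fin n → X) × X => Function.update q.1 i q.2 := by fun_prop
  have hm : Measurable fun q : (Fin n → X) × X =>
      ∫⁻ y, F (q, y) ∂K (Function.update q.1 i q.2) :=
    Measurable.lintegral_kernel_prod_right' (κ := K.comap _ hu) hF
  rw [← lintegral_pi_swap (fun _ => P) i hm]
  simp

lemma measurable_query_apply (hφ : Measurable (Function.uncurry φ)) (i : Fin n) :
    Measurable fun q : (Fin n → X) × Y => φ q.2 (q.1 i) :=
  hφ.comp (measurable_snd.prodMk ((measurable_pi_apply i).comp measurable_fst))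

/-- Under `ε`-differential privacy, conditioning on the output tilts the distribution of the query
at the `i`-th sample point by at most the tilt of a Bernoulli distribution. Hence its exponential
moment is bounded as in Hoeffding's lemma with `ε + μ` in place of `μ`. -/
lemma lintegral_exp_query_mul_le {ε μ : ℝ} (hε : 0 ≤ ε) (hμ : 0 ≤ μ)
    (hφ : Measurable (Function.uncurry φ)) (h01 : ∀ y x, φ y x ∈ Set.Icc (0 : ℝ) 1) (i : Fin n)
    (hK : ∀ S x, ∀ h : Y → ℝ≥0∞, Measurable h →
      ∫⁻ y, h y ∂K S ≤ ENNReal.ofReal (Real.exp ε) * ∫⁻ y, h y ∂K (Function.update S i x))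
    {u : (Fin n → X) × Y → ℝ≥0∞} (hu : Measurable u)
    (hui : ∀ S x y, u (Function.update S i x, y) = u (S, y))
    (hfin : ∫⁻ S, ∫⁻ y, u (S, y) ∂K S ∂Measure.pi (fun _ => P) ≠ ⊤) :
    ∫⁻ S, ∫⁻ y, ENNReal.ofReal (Real.exp (μ * (φ y (S i) - ∫ x, φ y x ∂P))) * u (S, y) ∂K S
        ∂Measure.pi (fun _ => P) ≤
      ENNReal.ofReal (Real.exp ((ε + μ) ^ 2 / 8)) *
        ∫⁻ S, ∫⁻ y, u (S, y) ∂K S ∂Measure.pi (fun _ => P) := by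
  set t : Y → ℝ := fun y => ∫ x, φ y x ∂P with ht
  have htm : Measurable t := measurable_integral_query hφ
  have ht01 : ∀ y, t y ∈ Set.Icc (0 : ℝ) 1 := fun y => integral_mem_Icc (h01 y)
  set D : Y → ℝ := fun y => 1 - t y + t y * Real.exp ε with hD
  have hE1 : 1 ≤ Real.exp ε := Real.one_le_exp hε
  have hM1 : 1 ≤ Real.exp μ := Real.one_le_exp hμ
  have hD1 : ∀ y, 1 ≤ D y := fun y => by
    have := mul_le_mul_of_nonneg_left hE1 (ht01 y).1
    simp only [hD]; linarith
  set w : Y → ℝ := fun y => Real.exp (-(μ * t y)) * (Real.exp μ - 1) / D y with hw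
  have hw0 : ∀ y, 0 ≤ w y := fun y => div_nonneg (mul_nonneg (Real.exp_pos _).le (by linarith))
    (by linarith [hD1 y])
  have hwm : Measurable w := by fun_prop
  have hqm := measurable_query_apply hφ (n := n) i
  have ht2 : Measurable fun q : (Fin n → X) × Y => t q.2 := htm.comp measurable_snd
  have hw2 : Measurable fun q : (Fin n → X) × Y => w q.2 := hwm.comp measurable_snd
  have hp1 : Measurable fun q : ((Fin n → X) × X) × Y => (q.1.1, q.2) := by fun_prop
  have hp2 : Measurable fun q : ((Fin n → X) × X) × Y => (q.2, q.1.2) := by fun_prop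
  -- the exchange of the `i`-th point with a fresh point
  have hIJ : ∫⁻ S, ∫⁻ y, ENNReal.ofReal (φ y (S i) * (1 - t y) * w y) * u (S, y) ∂K S
        ∂Measure.pi (fun _ => P) ≤ ENNReal.ofReal (Real.exp ε) *
      ∫⁻ S, ∫⁻ y, ENNReal.ofReal (t y * (1 - φ y (S i)) * w y) * u (S, y) ∂K S
        ∂Measure.pi (fun _ => P) := by
    let F : ((Fin n → X) × X) × Y → ℝ≥0∞ := fun q => ENNReal.ofReal (1 - φ q.2 q.1.2) *
      (ENNReal.ofReal (φ q.2 (q.1.1 i) * w q.2) * u (q.1.1, q.2))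
    have hF : Measurable F :=
      ((hφ.comp hp2).const_sub 1).ennreal_ofReal.mul
        (((hqm.mul hw2).ennreal_ofReal.mul hu).comp hp1)
    calc ∫⁻ S, ∫⁻ y, ENNReal.ofReal (φ y (S i) * (1 - t y) * w y) * u (S, y) ∂K S
          ∂Measure.pi (fun _ => P)
        = ∫⁻ S, ∫⁻ x', ∫⁻ y, F ((S, x'), y) ∂K S ∂P ∂Measure.pi (fun _ => P) := by
          refine lintegral_congr fun S => ?_
          have := lintegral_fresh_point (K := K) (P := P) (φ := fun y x => 1 - φ y x)
            (hφ.const_sub 1) (fun y x => ⟨by linarith [(h01 y x).2], by linarith [(h01 y x).1]⟩)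
            ((hqm.mul hw2).ennreal_ofReal.mul hu) S
          refine Eq.trans ?_ this.symm
          refine lintegral_congr fun y => ?_
          have h1 : ∫ x, (1 - φ y x) ∂P = 1 - t y := by
            have hi : Integrable (fun x => φ y x) P :=
              integrable_of_mem_Icc (hφ.comp measurable_prodMk_left) (h01 y)
            rw [integral_sub (integrable_const _) hi]
            simp [ht]
          rw [h1, Pi.mul_apply, ← mul_assoc, Pi.mul_apply,
            ← ENNReal.ofReal_mul (by linarith [(ht01 y).2])]
          congr 2
          ring
      _ ≤ ∫⁻ S, ∫⁻ x', ENNReal.ofReal (Real.exp ε) *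
            ∫⁻ y, F ((S, x'), y) ∂K (Function.update S i x') ∂P ∂Measure.pi (fun _ => P) :=
          lintegral_mono fun S => lintegral_mono fun x' =>
            hK S x' _ (hF.comp measurable_prodMk_left)
      _ = ENNReal.ofReal (Real.exp ε) * ∫⁻ S, ∫⁻ x',
            ∫⁻ y, F ((S, x'), y) ∂K (Function.update S i x') ∂P ∂Measure.pi (fun _ => P) := by
          simp_rw [lintegral_const_mul' _ _ ENNReal.ofReal_ne_top]
      _ = ENNReal.ofReal (Real.exp ε) * ∫⁻ S, ∫⁻ x', ∫⁻ y, ENNReal.ofReal (φ y x') *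
            (ENNReal.ofReal ((1 - φ y (S i)) * w y) * u (S, y)) ∂K S ∂P
            ∂Measure.pi (fun _ => P) := by
          rw [lintegral_kernel_update i hF]
          congr 1
          refine lintegral_congr fun S => lintegral_congr fun x' => lintegral_congr fun y => ?_
          simp only [F, Function.update_self, hui]
          rw [← mul_assoc, ← mul_assoc, ← ENNReal.ofReal_mul (by linarith [(h01 y (S i)).2]),
            ← ENNReal.ofReal_mul (h01 y x').1]
          congr 2
          ring
      _ = _ := by
          congr 1
          refine lintegral_congr fun S => ?_
          have := lintegral_fresh_point (K := K) (P := P) hφ h01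
            (((hqm.const_sub 1).mul hw2).ennreal_ofReal.mul hu) S
          refine Eq.trans this ?_
          refine lintegral_congr fun y => ?_
          rw [Pi.mul_apply, Pi.mul_apply, ← mul_assoc, ← ENNReal.ofReal_mul (ht01 y).1]
          congr 2
          ring
  set J := ∫⁻ S, ∫⁻ y, ENNReal.ofReal (t y * (1 - φ y (S i)) * w y) * u (S, y) ∂K S
        ∂Measure.pi (fun _ => P) with hJ
  have hJfin : ENNReal.ofReal (Real.exp ε) * J ≠ ⊤ := by
    refine ENNReal.mul_ne_top ENNReal.ofReal_ne_top (ne_top_of_le_ne_top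
      (ENNReal.mul_ne_top (ENNReal.ofReal_ne_top (r := Real.exp μ - 1)) hfin) ?_)
    simp_rw [hJ, ← lintegral_const_mul' _ _ (ENNReal.ofReal_ne_top (r := Real.exp μ - 1))]
    refine lintegral_mono fun S => lintegral_mono fun y => ?_
    dsimp only
    gcongr
    have h1 : w y ≤ Real.exp μ - 1 := by
      refine (div_le_self (mul_nonneg (Real.exp_pos _).le (by linarith)) (hD1 y)).trans ?_
      refine mul_le_of_le_one_left (by linarith) (Real.exp_le_one_iff.2 ?_)
      have := mul_nonneg hμ (ht01 y).1
      linarith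
    have h2 : t y * (1 - φ y (S i)) ≤ 1 :=
      mul_le_one₀ (ht01 y).2 (by linarith [(h01 y (S i)).2]) (by linarith [(h01 y (S i)).1])
    exact (mul_le_of_le_one_left (hw0 y) h2).trans h1
  have hpt : ∀ S y, ENNReal.ofReal (Real.exp (μ * (φ y (S i) - t y))) * u (S, y) +
        ENNReal.ofReal (Real.exp ε) *
          (ENNReal.ofReal (t y * (1 - φ y (S i)) * w y) * u (S, y)) ≤
      ENNReal.ofReal (φ y (S i) * (1 - t y) * w y) * u (S, y) +
        ENNReal.ofReal (Real.exp ((ε + μ) ^ 2 / 8)) * u (S, y) := by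
    intro S y
    obtain ⟨ha0, ha1⟩ := h01 y (S i)
    obtain ⟨hb0, hb1⟩ := ht01 y
    have hwy := hw0 y
    rw [← mul_assoc, ← add_mul, ← add_mul, ← ENNReal.ofReal_mul (Real.exp_pos _).le,
      ← ENNReal.ofReal_add (Real.exp_pos _).le (mul_nonneg (Real.exp_pos _).le
        (mul_nonneg (mul_nonneg hb0 (by linarith)) hwy)),
      ← ENNReal.ofReal_add (mul_nonneg (mul_nonneg ha0 (by linarith)) hwy) (Real.exp_pos _).le]
    refine mul_le_mul' (ENNReal.ofReal_le_ofReal ?_) le_rfl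
    set a := φ y (S i)
    set b := t y
    have hDpos : 0 < D y := by linarith [hD1 y]
    have hDw : D y * w y = Real.exp (-(μ * b)) * (Real.exp μ - 1) := by
      simp only [hw]; rw [mul_div_cancel₀ _ hDpos.ne']
    -- convexity of the exponential function in the value of the query
    have hconv : Real.exp (μ * (a - b)) ≤ Real.exp (-(μ * b)) * (1 + a * (Real.exp μ - 1)) := by
      have h1 : Real.exp (a * μ) ≤ 1 + a * (Real.exp μ - 1) := by
        have := convexOn_exp.2 (Set.mem_univ 0) (Set.mem_univ μ) (by linarith : 0 ≤ 1 - a) ha0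
          (by ring)
        simp only [smul_eq_mul, mul_zero, zero_add, Real.exp_zero, mul_one] at this
        linarith
      calc Real.exp (μ * (a - b)) = Real.exp (-(μ * b)) * Real.exp (a * μ) := by
            rw [← Real.exp_add]; congr 1; ring
        _ ≤ _ := by gcongr
    have hcst : Real.exp (-(μ * b)) + Real.exp ε * b * w y ≤ Real.exp ((ε + μ) ^ 2 / 8) := by
      have h1 : Real.exp (-(μ * b)) + Real.exp ε * b * w y =
          Real.exp (-(μ * b)) * (1 - b + b * Real.exp (ε + μ)) / D y := by
        rw [eq_div_iff hDpos.ne', add_mul, mul_assoc _ (w y), mul_comm (w y), hDw, Real.exp_add]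
        simp only [hD]
        ring
      have h2 : Real.exp (b * ε) ≤ D y := by
        have := convexOn_exp.2 (Set.mem_univ 0) (Set.mem_univ ε) (by linarith : 0 ≤ 1 - b) hb0
          (by ring)
        simpa only [smul_eq_mul, mul_zero, zero_add, Real.exp_zero, mul_one] using this
      rw [h1, div_le_iff₀ hDpos]
      calc Real.exp (-(μ * b)) * (1 - b + b * Real.exp (ε + μ))
          ≤ Real.exp (-(μ * b)) * Real.exp (b * (ε + μ) + (ε + μ) ^ 2 / 8) := by
            gcongr
            exact one_sub_add_mul_exp_le ⟨hb0, hb1⟩ _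
        _ = Real.exp ((ε + μ) ^ 2 / 8) * Real.exp (b * ε) := by
            rw [← Real.exp_add, ← Real.exp_add]; congr 1; ring
        _ ≤ _ := by gcongr
    have hsplit : Real.exp (-(μ * b)) * (a * (Real.exp μ - 1)) =
        a * (1 - b) * w y + Real.exp ε * b * w y - Real.exp ε * (b * (1 - a) * w y) := by
      rw [mul_left_comm, ← hDw]
      simp only [hD]
      ring
    linarith
  have hI := lintegral_mono (μ := Measure.pi fun _ : Fin n => P)
    fun S => lintegral_mono (μ := K S) fun y => hpt S y
  have hm1 : Measurable fun q : (Fin n → X) × Y =>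
      ENNReal.ofReal (Real.exp (μ * (φ q.2 (q.1 i) - t q.2))) * u q :=
    (((hqm.sub ht2).const_mul μ).exp.ennreal_ofReal).mul hu
  have hm2 : Measurable fun q : (Fin n → X) × Y =>
      ENNReal.ofReal (φ q.2 (q.1 i) * (1 - t q.2) * w q.2) * u q :=
    (((hqm.mul (ht2.const_sub 1)).mul hw2).ennreal_ofReal).mul hu
  have e1 : ∀ S, ∫⁻ y, _ ∂K S = _ := fun S =>
    lintegral_add_left (μ := K S) (hm1.comp (measurable_prodMk_left (x := S)))
      (fun y => ENNReal.ofReal (Real.exp ε) *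
          (ENNReal.ofReal (t y * (1 - φ y (S i)) * w y) * u (S, y)))
  have e2 : ∀ S, ∫⁻ y, _ ∂K S = _ := fun S =>
    lintegral_add_left (μ := K S) (hm2.comp (measurable_prodMk_left (x := S)))
      (fun y => ENNReal.ofReal (Real.exp ((ε + μ) ^ 2 / 8)) * u (S, y))
  simp only [Function.comp_apply] at e1 e2
  simp_rw [e1, e2, lintegral_const_mul' _ _ ENNReal.ofReal_ne_top] at hI
  rw [lintegral_add_left hm1.lintegral_kernel_prod_right',
    lintegral_add_left hm2.lintegral_kernel_prod_right',
    lintegral_const_mul' _ _ ENNReal.ofReal_ne_top,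
    lintegral_const_mul' _ _ ENNReal.ofReal_ne_top, ← hJ] at hI
  have hI2 := hI.trans (add_le_add_left hIJ _)
  rw [add_comm] at hI2
  exact (ENNReal.add_le_add_iff_left hJfin).1 hI2

lemma lintegral_prod_exp_query_le {ε μ : ℝ} (hε : 0 ≤ ε) (hμ : 0 ≤ μ)
    (hφ : Measurable (Function.uncurry φ)) (h01 : ∀ y x, φ y x ∈ Set.Icc (0 : ℝ) 1)
    (hK : ∀ S i x, ∀ h : Y → ℝ≥0∞, Measurable h →
      ∫⁻ y, h y ∂K S ≤ ENNReal.ofReal (Real.exp ε) * ∫⁻ y, h y ∂K (Function.update S i x))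
    (s : Finset (Fin n)) :
    ∫⁻ S, ∫⁻ y, ∏ i ∈ s, ENNReal.ofReal (Real.exp (μ * (φ y (S i) - ∫ x, φ y x ∂P))) ∂K S
        ∂Measure.pi (fun _ => P) ≤
      ENNReal.ofReal (Real.exp ((ε + μ) ^ 2 / 8)) ^ s.card := by
  induction s using Finset.induction_on with
  | empty => simp
  | insert i s hi ih =>
    simp_rw [Finset.prod_insert hi, Finset.card_insert_of_notMem hi]
    rw [pow_succ' (ENNReal.ofReal (Real.exp ((ε + μ) ^ 2 / 8)))]
    refine (lintegral_exp_query_mul_le hε hμ hφ h01 i (fun S x => hK S i x)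
      (u := fun q => ∏ i ∈ s, ENNReal.ofReal (Real.exp (μ * (φ q.2 (q.1 i) - ∫ x, φ q.2 x ∂P))))
      ?_ ?_ ?_).trans (mul_le_mul' le_rfl ih)
    · exact Finset.measurable_prod _ fun j _ => (((measurable_query_apply hφ j).sub
        ((measurable_integral_query hφ).comp measurable_snd)).const_mul μ).exp.ennreal_ofReal
    · intro S x y
      refine Finset.prod_congr rfl fun j hj => ?_
      have : j ≠ i := fun h => hi (h ▸ hj)
      simp [Function.update_of_ne this]
    · exact ne_top_of_le_ne_top (ENNReal.pow_ne_top ENNReal.ofReal_ne_top) ih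

lemma measurable_empiricalMean (hφ : Measurable (Function.uncurry φ)) :
    Measurable fun q : (Fin n → X) × Y => empiricalMean q.1 (φ q.2) :=
  (Finset.measurable_sum _ fun i _ => measurable_query_apply hφ i).div_const _

/-- Generalization under pure differential privacy: the query chosen by a `τ`-differentially
private mechanism exceeds its expectation by `τ` with probability at most `exp (-n τ²)`. -/
theorem lintegral_measure_gap_le_of_pure {τ ε : ℝ} (hε : 0 ≤ ε) (hετ : ε ≤ τ)
    (hφ : Measurable (Function.uncurry φ)) (h01 : ∀ y x, φ y x ∈ Set.Icc (0 : ℝ) 1)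
    (hK : ∀ S i x, ∀ h : Y → ℝ≥0∞, Measurable h →
      ∫⁻ y, h y ∂K S ≤ ENNReal.ofReal (Real.exp ε) * ∫⁻ y, h y ∂K (Function.update S i x)) :
    ∫⁻ S, K S {y | τ ≤ empiricalMean S (φ y) - ∫ x, φ y x ∂P} ∂Measure.pi (fun _ => P) ≤
      ENNReal.ofReal (Real.exp (-(n * τ ^ 2))) := by
  have hτ : 0 ≤ τ := hε.trans hετ
  -- the exponent `(ε + μ)² / 8 - μ τ` with `ε = τ` is minimal at `μ = 3 τ`
  have hprod := lintegral_prod_exp_query_le (P := P) (μ := 3 * τ) hε (by linarith) hφ h01 hK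
    Finset.univ
  have hpt : ∀ S : Fin n → X, K S {y | τ ≤ empiricalMean S (φ y) - ∫ x, φ y x ∂P} ≤
      ENNReal.ofReal (Real.exp (-(n * (3 * τ ^ 2)))) *
        ∫⁻ y, ∏ i, ENNReal.ofReal (Real.exp (3 * τ * (φ y (S i) - ∫ x, φ y x ∂P))) ∂K S := by
    intro S
    have hms : MeasurableSet {y | τ ≤ empiricalMean S (φ y) - ∫ x, φ y x ∂P} :=
      measurableSet_le measurable_const
        (((measurable_empiricalMean hφ).comp measurable_prodMk_left).sub
          (measurable_integral_query hφ))
    rw [← lintegral_indicator_one hms, ← lintegral_const_mul' _ _ ENNReal.ofReal_ne_top]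
    refine lintegral_mono fun y => ?_
    by_cases hy : τ ≤ empiricalMean S (φ y) - ∫ x, φ y x ∂P
    swap
    · rw [Set.indicator_of_notMem (by exact hy)]
      exact zero_le
    rw [Set.indicator_of_mem (by exact hy), Pi.one_apply, ← ENNReal.ofReal_prod_of_nonneg fun i _ => (Real.exp_pos _).le,
      ← Real.exp_sum, ← ENNReal.ofReal_mul (Real.exp_pos _).le, ← Real.exp_add]
    refine ENNReal.one_le_ofReal.2 (Real.one_le_exp ?_)
    simp only [empiricalMean] at hy
    rw [← Finset.mul_sum, Finset.sum_sub_distrib]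
    simp only [Finset.sum_const, Finset.card_univ, Fintype.card_fin, nsmul_eq_mul]
    rcases Nat.eq_zero_or_pos n with hn | hn
    · subst hn; simp
    · have hn' : (0 : ℝ) < n := by exact_mod_cast hn
      have h1 : (n : ℝ) * τ ≤ ∑ i, φ y (S i) - n * ∫ x, φ y x ∂P := by
        have := mul_le_mul_of_nonneg_left hy hn'.le
        rwa [mul_sub, mul_div_cancel₀ _ hn'.ne'] at this
      nlinarith
  calc _ ≤ ∫⁻ S, ENNReal.ofReal (Real.exp (-(n * (3 * τ ^ 2)))) *
        ∫⁻ y, ∏ i, ENNReal.ofReal (Real.exp (3 * τ * (φ y (S i) - ∫ x, φ y x ∂P))) ∂K S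
          ∂Measure.pi (fun _ => P) := lintegral_mono hpt
    _ ≤ ENNReal.ofReal (Real.exp (-(n * (3 * τ ^ 2)))) *
        ENNReal.ofReal (Real.exp ((ε + 3 * τ) ^ 2 / 8)) ^ (Finset.univ : Finset (Fin n)).card := by
        rw [lintegral_const_mul' _ _ ENNReal.ofReal_ne_top]
        gcongr
    _ ≤ _ := by
        rw [Finset.card_univ, Fintype.card_fin, ← ENNReal.ofReal_pow (Real.exp_pos _).le,
          ← Real.exp_nat_mul, ← ENNReal.ofReal_mul (Real.exp_pos _).le, ← Real.exp_add]
        refine ENNReal.ofReal_le_ofReal (Real.exp_le_exp.2 ?_)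
        have h1 : (ε + 3 * τ) ^ 2 ≤ (4 * τ) ^ 2 := by gcongr; linarith
        have hn' : (0 : ℝ) ≤ n := Nat.cast_nonneg n
        nlinarith

end Generalization

lemma abs_empiricalMean_update_sub_le {X : Type*} {n : ℕ} {g : X → ℝ}
    (hg : ∀ x, g x ∈ Set.Icc (0 : ℝ) 1) (S : Fin n → X) (i : Fin n) (x : X) :
    |empiricalMean (Function.update S i x) g - empiricalMean S g| ≤ 1 / n := by
  have h1 : ∑ j, g (Function.update S i x j) - ∑ j, g (S j) = g x - g (S i) := by
    rw [← Finset.sum_sub_distrib, Finset.sum_eq_single i]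
    · simp
    · intro j _ hj
      simp [Function.update_of_ne hj]
    · simp
  rw [empiricalMean, empiricalMean, ← sub_div, h1, abs_div, Nat.abs_cast]
  gcongr
  have := hg x
  have := hg (S i)
  simp only [Set.mem_Icc] at *
  rw [abs_le]
  constructor <;> linarith

lemma empiricalMean_mem_Icc {X : Type*} {n : ℕ} {g : X → ℝ}
    (hg : ∀ x, g x ∈ Set.Icc (0 : ℝ) 1) (S : Fin n → X) :
    empiricalMean S g ∈ Set.Icc (0 : ℝ) 1 := by
  refine ⟨div_nonneg (Finset.sum_nonneg fun i _ => (hg _).1) (Nat.cast_nonneg n), ?_⟩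
  refine div_le_one_of_le₀ ?_ (Nat.cast_nonneg n)
  calc ∑ i, g (S i) ≤ ∑ _i : Fin n, (1 : ℝ) := Finset.sum_le_sum fun i _ => (hg _).2
    _ = n := by simp

/-- The weight `exp (-l (τ - x)⁺)` of a deviation `x`; it is `1` from the threshold `τ` on. -/
noncomputable def deviationWeight (l τ x : ℝ) : ℝ := Real.exp (-(l * max 0 (τ - x)))

lemma measurable_deviationWeight (l τ : ℝ) : Measurable (deviationWeight l τ) := by
  unfold deviationWeight; fun_prop

lemma deviationWeight_le_one {l : ℝ} (hl : 0 ≤ l) (τ x : ℝ) : deviationWeight l τ x ≤ 1 :=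
  Real.exp_le_one_iff.2 (neg_nonpos.2 (mul_nonneg hl (le_max_left _ _)))

lemma deviationWeight_le {l : ℝ} (hl : 0 ≤ l) (τ : ℝ) {x y r : ℝ} (h : |x - y| ≤ r) :
    deviationWeight l τ x ≤ Real.exp (l * r) * deviationWeight l τ y := by
  rw [deviationWeight, deviationWeight, ← Real.exp_add, Real.exp_le_exp]
  have h1 : max 0 (τ - y) ≤ max 0 (τ - x) + r := by
    have hr := (abs_nonneg _).trans h
    have := le_max_left 0 (τ - x)
    have := le_max_right 0 (τ - x)
    rw [max_le_iff]
    constructor <;> linarith [abs_le.1 h]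
  nlinarith

/-- Under the weight, deviations below `τ / 2` are negligible. -/
lemma sub_mul_deviationWeight_le {l τ : ℝ} (hτ : 0 < τ) (hl : 1 ≤ l * τ) (x : ℝ) :
    (τ / 2 - x) * deviationWeight l τ x ≤ τ / 2 * Real.exp (-(l * τ / 2)) := by
  have hl0 : 0 < l := by by_contra h; nlinarith
  rcases le_or_gt (τ / 2) x with hx | hx
  · have : 0 < deviationWeight l τ x := Real.exp_pos _
    have h2 : 0 < τ / 2 * Real.exp (-(l * τ / 2)) := by positivity
    nlinarith
  · set u := τ / 2 - x with hu
    have hw : deviationWeight l τ x = Real.exp (-(l * τ / 2)) * Real.exp (-(l * u)) := by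
      rw [deviationWeight, max_eq_right (by linarith), ← Real.exp_add]
      congr 1
      rw [hu]; ring
    have h1 : l * u * Real.exp (-(l * u)) ≤ 1 / 2 := by
      have ha := Real.add_one_le_exp (l * u - 1)
      have hb := Real.exp_pos (-(l * u))
      have hc : Real.exp (l * u - 1) * Real.exp (-(l * u)) = Real.exp (-1) := by
        rw [← Real.exp_add]; congr 1; ring
      have hd : Real.exp (-1) ≤ 1 / 2 := by
        rw [Real.exp_neg, inv_eq_one_div]
        exact one_div_le_one_div_of_le two_pos (by linarith [Real.add_one_le_exp (1 : ℝ)])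
      nlinarith
    have h2 : u * Real.exp (-(l * u)) ≤ τ / 2 := by
      refine le_of_mul_le_mul_left ?_ hl0
      nlinarith
    rw [hw]
    calc u * (Real.exp (-(l * τ / 2)) * Real.exp (-(l * u)))
        = (u * Real.exp (-(l * u))) * Real.exp (-(l * τ / 2)) := by ring
      _ ≤ _ := by gcongr

section Generalization

open ProbabilityTheory

variable {X Y : Type*} [MeasurableSpace X] [MeasurableSpace Y] {P : Measure X}
  [IsProbabilityMeasure P] {n : ℕ} {K : Kernel (Fin n → X) Y} [IsMarkovKernel K]
  {φ : Y → X → ℝ}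

lemma lintegral_query_mul_le_of_approx {a d l r : ℝ}
    (hφ : Measurable (Function.uncurry φ)) (h01 : ∀ y x, φ y x ∈ Set.Icc (0 : ℝ) 1) (i : Fin n)
    (hK : ∀ S x, ∀ h : Y → ℝ≥0∞, Measurable h → (∀ y, h y ≤ 1) →
      ∫⁻ y, h y ∂K S ≤
        ENNReal.ofReal a * ∫⁻ y, h y ∂K (Function.update S i x) + ENNReal.ofReal d)
    {w : (Fin n → X) × Y → ℝ≥0∞} (hw : Measurable w) (hw1 : ∀ q, w q ≤ 1)
    (hwi : ∀ S x y, w (Function.update S i x, y) ≤ ENNReal.ofReal (Real.exp (l * r)) * w (S, y)) :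
    ∫⁻ S, ∫⁻ y, ENNReal.ofReal (φ y (S i)) * w (S, y) ∂K S ∂Measure.pi (fun _ => P) ≤
      ENNReal.ofReal a * (ENNReal.ofReal (Real.exp (l * r)) *
        ∫⁻ S, ∫⁻ y, ENNReal.ofReal (∫ x, φ y x ∂P) * w (S, y) ∂K S ∂Measure.pi (fun _ => P)) +
      ENNReal.ofReal d := by
  let F : ((Fin n → X) × X) × Y → ℝ≥0∞ := fun q =>
    ENNReal.ofReal (φ q.2 (q.1.1 i)) * w (q.1.1, q.2)
  have hqm := measurable_query_apply hφ (n := n) i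
  have hF : Measurable F := by
    have hp1 : Measurable fun q : ((Fin n → X) × X) × Y => (q.1.1, q.2) := by fun_prop
    exact (hqm.ennreal_ofReal.mul hw).comp hp1
  have hF1 : ∀ q, F q ≤ 1 := fun q => mul_le_one' (ENNReal.ofReal_le_one.2 (h01 _ _).2) (hw1 _)
  calc ∫⁻ S, ∫⁻ y, ENNReal.ofReal (φ y (S i)) * w (S, y) ∂K S ∂Measure.pi (fun _ => P)
      = ∫⁻ S, ∫⁻ x', ∫⁻ y, F ((S, x'), y) ∂K S ∂P ∂Measure.pi (fun _ => P) := by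
        simp [F]
    _ ≤ ∫⁻ S, ∫⁻ x', (ENNReal.ofReal a *
          ∫⁻ y, F ((S, x'), y) ∂K (Function.update S i x') + ENNReal.ofReal d) ∂P
          ∂Measure.pi (fun _ => P) :=
        lintegral_mono fun S => lintegral_mono fun x' =>
          hK S x' _ (hF.comp measurable_prodMk_left) fun y => hF1 _
    _ = ENNReal.ofReal a * ∫⁻ S, ∫⁻ x', ∫⁻ y, F ((S, x'), y) ∂K (Function.update S i x') ∂P
          ∂Measure.pi (fun _ => P) + ENNReal.ofReal d := by
        simp_rw [lintegral_add_right _ measurable_const,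
          lintegral_const_mul' _ _ ENNReal.ofReal_ne_top]
        simp
    _ = ENNReal.ofReal a * ∫⁻ S, ∫⁻ x', ∫⁻ y, ENNReal.ofReal (φ y x') *
          w (Function.update S i x', y) ∂K S ∂P ∂Measure.pi (fun _ => P) +
          ENNReal.ofReal d := by
        rw [lintegral_kernel_update i hF]
        simp [F]
    _ ≤ ENNReal.ofReal a * ∫⁻ S, ∫⁻ x', ∫⁻ y, ENNReal.ofReal (Real.exp (l * r)) *
          (ENNReal.ofReal (φ y x') * w (S, y)) ∂K S ∂P ∂Measure.pi (fun _ => P) +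
          ENNReal.ofReal d := by
        refine add_le_add (mul_le_mul' le_rfl (lintegral_mono fun S => lintegral_mono fun x' =>
          lintegral_mono fun y => ?_)) le_rfl
        dsimp only
        rw [mul_left_comm]
        exact mul_le_mul' le_rfl (hwi S x' y)
    _ = _ := by
        simp_rw [lintegral_const_mul' _ _ ENNReal.ofReal_ne_top, lintegral_fresh_point hφ h01 hw]

/-- Generalization under approximate differential privacy. The joint law of sample and output is
reweighted by `deviationWeight`, which puts most of the mass on deviations of at least `τ / 2`;
privacy and the slow variation of the weight, on the other hand, keep the reweighted mean
deviation below `τ / 4`, up to the error term `d`. -/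
theorem lintegral_measure_gap_le_of_approx {τ l a d : ℝ} (hn : 0 < n) (hτ : 0 < τ)
    (hl : 1 ≤ l * τ) (ha : 0 ≤ a) (hd : 0 ≤ d) (hal : a * Real.exp (l * (1 / n)) ≤ 1 + τ / 4)
    (hφ : Measurable (Function.uncurry φ)) (h01 : ∀ y x, φ y x ∈ Set.Icc (0 : ℝ) 1)
    (hK : ∀ S i x, ∀ h : Y → ℝ≥0∞, Measurable h → (∀ y, h y ≤ 1) →
      ∫⁻ y, h y ∂K S ≤
        ENNReal.ofReal a * ∫⁻ y, h y ∂K (Function.update S i x) + ENNReal.ofReal d) :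
    ∫⁻ S, K S {y | τ ≤ empiricalMean S (φ y) - ∫ x, φ y x ∂P} ∂Measure.pi (fun _ => P) ≤
      ENNReal.ofReal (4 * d / τ + 2 * Real.exp (-(l * τ / 2))) := by
  have hl0 : 0 < l := by by_contra h; nlinarith
  have hn' : (0 : ℝ) < n := by exact_mod_cast hn
  set t : Y → ℝ := fun y => ∫ x, φ y x ∂P with ht
  have ht01 : ∀ y, t y ∈ Set.Icc (0 : ℝ) 1 := fun y => integral_mem_Icc (h01 y)
  have htm : Measurable fun q : (Fin n → X) × Y => t q.2 :=
    (measurable_integral_query hφ).comp measurable_snd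
  have hgm : Measurable fun q : (Fin n → X) × Y => empiricalMean q.1 (φ q.2) - t q.2 :=
    (measurable_empiricalMean hφ).sub htm
  set wr : (Fin n → X) → Y → ℝ := fun S y => deviationWeight l τ (empiricalMean S (φ y) - t y)
    with hwr
  have hwr0 : ∀ S y, 0 < wr S y := fun S y => Real.exp_pos _
  let w : (Fin n → X) × Y → ℝ≥0∞ := fun q => ENNReal.ofReal (wr q.1 q.2)
  have hw : Measurable w := ((measurable_deviationWeight l τ).comp hgm).ennreal_ofReal
  have hw1 : ∀ q, w q ≤ 1 := fun q =>
    ENNReal.ofReal_le_one.2 (deviationWeight_le_one hl0.le _ _)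
  have hwi : ∀ i S x y, w (Function.update S i x, y) ≤
      ENNReal.ofReal (Real.exp (l * (1 / n))) * w (S, y) := by
    intro i S x y
    rw [← ENNReal.ofReal_mul (Real.exp_pos _).le]
    refine ENNReal.ofReal_le_ofReal (deviationWeight_le hl0.le τ ?_)
    rw [sub_sub_sub_cancel_right]
    exact abs_empiricalMean_update_sub_le (h01 y) S i x
  set M := ∫⁻ S, ∫⁻ y, w (S, y) ∂K S ∂Measure.pi (fun _ => P) with hM
  set N := ∫⁻ S, ∫⁻ y, ENNReal.ofReal (t y) * w (S, y) ∂K S ∂Measure.pi (fun _ => P) with hN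
  set c := τ / 2 * Real.exp (-(l * τ / 2)) with hc
  have hc0 : 0 < c := by positivity
  have hNM : N ≤ M := lintegral_mono fun S => lintegral_mono fun y =>
    mul_le_of_le_one_left zero_le (ENNReal.ofReal_le_one.2 (ht01 y).2)
  have hM1 : M ≤ 1 := by
    calc M ≤ ∫⁻ _S, ∫⁻ _y, 1 ∂K _S ∂Measure.pi (fun _ => P) :=
          lintegral_mono fun S => lintegral_mono fun y => hw1 _
      _ = 1 := by simp
  -- the reweighted mean of the query on the sample
  have hmean : ∫⁻ S, ∫⁻ y, ENNReal.ofReal (empiricalMean S (φ y)) * w (S, y) ∂K S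
      ∂Measure.pi (fun _ => P) ≤
      ENNReal.ofReal a * (ENNReal.ofReal (Real.exp (l * (1 / n))) * N) + ENNReal.ofReal d := by
    have hsum : ∀ S y, ENNReal.ofReal (empiricalMean S (φ y)) * w (S, y) =
        ENNReal.ofReal (1 / n) * ∑ i, ENNReal.ofReal (φ y (S i)) * w (S, y) := by
      intro S y
      rw [empiricalMean, div_eq_inv_mul, ← one_div, ENNReal.ofReal_mul (by positivity),
        ENNReal.ofReal_sum_of_nonneg fun i _ => (h01 _ _).1, mul_assoc, Finset.sum_mul]
    have hm : ∀ i : Fin n, Measurable fun q : (Fin n → X) × Y =>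
        ENNReal.ofReal (φ q.2 (q.1 i)) * w q := fun i =>
      (measurable_query_apply hφ i).ennreal_ofReal.mul hw
    have e1 : ∀ S, ∫⁻ y, ∑ i, ENNReal.ofReal (φ y (S i)) * w (S, y) ∂K S =
        ∑ i, ∫⁻ y, ENNReal.ofReal (φ y (S i)) * w (S, y) ∂K S := fun S =>
      lintegral_finsetSum _ fun i _ => (hm i).comp measurable_prodMk_left
    simp_rw [hsum, lintegral_const_mul' _ _ ENNReal.ofReal_ne_top, e1]
    rw [lintegral_finsetSum _ fun i _ => (hm i).lintegral_kernel_prod_right']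
    calc _ ≤ ENNReal.ofReal (1 / n) * ∑ _i : Fin n, (ENNReal.ofReal a *
            (ENNReal.ofReal (Real.exp (l * (1 / n))) * N) + ENNReal.ofReal d) :=
          mul_le_mul' le_rfl (Finset.sum_le_sum fun i _ => lintegral_query_mul_le_of_approx
            hφ h01 i (fun S x => hK S i x) hw hw1 (hwi i))
      _ = _ := by
          rw [Finset.sum_const, Finset.card_univ, Fintype.card_fin, nsmul_eq_mul, ← mul_assoc,
            ← ENNReal.ofReal_natCast n, ← ENNReal.ofReal_mul (by positivity),
            one_div_mul_cancel hn'.ne', ENNReal.ofReal_one, one_mul]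
  have hpt : ∀ S y, ENNReal.ofReal (τ / 2) * w (S, y) + ENNReal.ofReal (t y) * w (S, y) ≤
      ENNReal.ofReal (empiricalMean S (φ y)) * w (S, y) + ENNReal.ofReal c := by
    intro S y
    have h1 := sub_mul_deviationWeight_le hτ hl (empiricalMean S (φ y) - t y)
    have h2 := hwr0 S y
    have h3 := (empiricalMean_mem_Icc (h01 y) S).1
    have h4 := (ht01 y).1
    simp only [w]
    rw [← ENNReal.ofReal_mul (by positivity), ← ENNReal.ofReal_mul h4, ← ENNReal.ofReal_mul h3,
      ← ENNReal.ofReal_add (by positivity) (by positivity),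
      ← ENNReal.ofReal_add (by positivity) hc0.le]
    refine ENNReal.ofReal_le_ofReal ?_
    simp only [hwr, hc] at *
    nlinarith
  have hI := lintegral_mono (μ := Measure.pi fun _ : Fin n => P)
    fun S => lintegral_mono (μ := K S) fun y => hpt S y
  have e1 : ∀ S, ∫⁻ y, (ENNReal.ofReal (τ / 2) * w (S, y) + ENNReal.ofReal (t y) * w (S, y)) ∂K S =
      ENNReal.ofReal (τ / 2) * ∫⁻ y, w (S, y) ∂K S +
        ∫⁻ y, ENNReal.ofReal (t y) * w (S, y) ∂K S := fun S => by
    have hwS : Measurable fun y => w (S, y) := hw.comp measurable_prodMk_left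
    rw [lintegral_add_left (hwS.const_mul _),
      lintegral_const_mul' _ _ ENNReal.ofReal_ne_top]
  simp_rw [e1, lintegral_add_right _ measurable_const] at hI
  simp only [lintegral_const, measure_univ, mul_one] at hI
  rw [lintegral_add_left (hw.lintegral_kernel_prod_right'.const_mul _),
    lintegral_const_mul' _ _ ENNReal.ofReal_ne_top, lintegral_add_right _ measurable_const,
    ← hM, ← hN] at hI
  simp only [lintegral_const, measure_univ, mul_one] at hI
  have hfin := hI.trans (add_le_add_left hmean _)
  obtain ⟨x, hx0, hx⟩ : ∃ x : ℝ, 0 ≤ x ∧ M = ENNReal.ofReal x :=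
    ⟨_, ENNReal.toReal_nonneg, (ENNReal.ofReal_toReal (ne_top_of_le_ne_top (by simp) hM1)).symm⟩
  obtain ⟨z, hz0, hz⟩ : ∃ x : ℝ, 0 ≤ x ∧ N = ENNReal.ofReal x :=
    ⟨_, ENNReal.toReal_nonneg,
      (ENNReal.ofReal_toReal (ne_top_of_le_ne_top (by simp) (hNM.trans hM1))).symm⟩
  have hMx : x ≤ 4 * d / τ + 2 * Real.exp (-(l * τ / 2)) := by
    have hzx : z ≤ x := by
      rw [hx, hz] at hNM
      exact (ENNReal.ofReal_le_ofReal_iff hx0).1 hNM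
    rw [hx, hz, ← ENNReal.ofReal_mul (by positivity), ← ENNReal.ofReal_mul (Real.exp_pos _).le,
      ← ENNReal.ofReal_mul ha, ← ENNReal.ofReal_add (by positivity) hz0,
      ← ENNReal.ofReal_add (by positivity) hd, ← ENNReal.ofReal_add (by positivity) hc0.le,
      ENNReal.ofReal_le_ofReal_iff (by positivity)] at hfin
    have h1 : a * (Real.exp (l * (1 / n)) * z) ≤ (1 + τ / 4) * z := by
      rw [← mul_assoc]; gcongr
    have h2 : τ / 4 * x ≤ d + c := by nlinarith
    have h3 : 4 * d / τ + 2 * Real.exp (-(l * τ / 2)) = (d + c) / (τ / 4) := by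
      rw [hc]; field_simp; ring
    rw [h3, le_div_iff₀ (by positivity)]
    linarith
  refine le_trans ?_ (ENNReal.ofReal_le_ofReal hMx)
  rw [← hx]
  refine lintegral_mono fun S => ?_
  have hms : MeasurableSet {y | τ ≤ empiricalMean S (φ y) - t y} :=
    measurableSet_le measurable_const (hgm.comp measurable_prodMk_left)
  rw [← lintegral_indicator_one hms]
  refine lintegral_mono fun y => ?_
  by_cases hy : τ ≤ empiricalMean S (φ y) - t y
  · rw [Set.indicator_of_mem (by exact hy)]
    simp only [w, hwr, deviationWeight, max_eq_left (sub_nonpos.2 hy)]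
    simp
  · rw [Set.indicator_of_notMem (by exact hy)]
    exact zero_le

end Generalization

namespace Thresholdout

/-! ### The law of the answers -/

section StateValue

variable {σ T : ℝ} {e f : (i : ℕ) → (Fin i → Answer) → ℝ} {h : (i : ℕ) → (Fin i → Answer) → ℝ≥0∞}

/-- The expectation of the payoff `h` of the final history when `k` queries remain, the remaining
budget is `b` and the current noisy threshold is `θ`. -/
noncomputable def stateValue (σ T : ℝ) (e f : (i : ℕ) → (Fin i → Answer) → ℝ)
    (h : (i : ℕ) → (Fin i → Answer) → ℝ≥0∞) (k i : ℕ) :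
    ℕ → (Fin i → Answer) → ℝ → ℝ≥0∞
  | 0, hist, _ => exhaustedValue h k i hist
  | b + 1, hist, θ => epochValue σ e f (budgetValue σ T e f h b) k i hist θ

lemma lintegral_stateValue (k i b : ℕ) (hist : Fin i → Answer) :
    ∫⁻ γ, stateValue σ T e f h k i b hist (T + γ) ∂laplaceMeasure (2 * σ) =
      budgetValue σ T e f h b k i hist := by
  cases b with
  | zero => simp [stateValue, budgetValue]
  | succ b => rfl

lemma stateValue_zero (i b : ℕ) (hist : Fin i → Answer) (θ : ℝ) :
    stateValue σ T e f h 0 i b hist θ = h i hist := by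
  cases b with
  | zero => rfl
  | succ b => exact budgetValue_zero_right b i hist

lemma measurable_stateValue (he : ∀ i, Measurable (e i)) (hf : ∀ i, Measurable (f i))
    (hh : ∀ i, Measurable (h i)) (k i : ℕ) :
    Measurable fun q : ℕ × (Fin i → Answer) × ℝ => stateValue σ T e f h k i q.1 q.2.1 q.2.2 := by
  refine measurable_from_prod_countable_right fun b => ?_
  cases b with
  | zero => exact (measurable_exhaustedValue hh k i).comp measurable_fst
  | succ b => exact measurable_epochValue he hf (measurable_budgetValue he hf hh b) k i

end StateValue

section Run

variable {X Ω : Type*} [MeasurableSpace X] [MeasurableSpace Ω] {m n t : ℕ}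

/-- The `i`-th query of the analyst, extended by `0` to all indices `i : ℕ`. -/
noncomputable def Analyst.extQuery (A : Analyst X Ω m) (ω : Ω) (i : ℕ) (hist : Fin i → Answer) :
    X → ℝ :=
  if h : i < m then A.query ⟨i, h⟩ ω hist else 0

lemma Analyst.extQuery_mem (A : Analyst X Ω m) (ω : Ω) (i : ℕ) (hist : Fin i → Answer) (x : X) :
    A.extQuery ω i hist x ∈ Set.Icc (0 : ℝ) 1 := by
  unfold Analyst.extQuery
  split_ifs with h
  · exact A.query_mem _ _ _ _
  · simp

lemma Analyst.measurable_extQuery (A : Analyst X Ω m) (i : ℕ) :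
    Measurable fun p : Ω × (Fin i → Answer) × X => A.extQuery p.1 i p.2.1 p.2.2 := by
  unfold Analyst.extQuery
  split_ifs with h
  · exact A.measurable_query ⟨i, h⟩
  · exact measurable_const

lemma Analyst.measurable_uncurry_extQuery (A : Analyst X Ω m) (ω : Ω) (i : ℕ) :
    Measurable (Function.uncurry (A.extQuery ω i)) :=
  (A.measurable_extQuery i).comp measurable_prodMk_left

lemma Analyst.measurable_empiricalMean_extQuery (A : Analyst X Ω m) (i : ℕ) :
    Measurable fun p : Ω × (Fin n → X) × (Fin i → Answer) =>
      empiricalMean p.2.1 (A.extQuery p.1 i p.2.2) := by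
  refine (Finset.measurable_sum _ fun j _ => ?_).div_const _
  exact (A.measurable_extQuery i).comp
    (f := fun p : Ω × (Fin n → X) × (Fin i → Answer) => (p.1, p.2.2, p.2.1 j)) (by fun_prop)

lemma measurable_run (A : Analyst X Ω m) (St : Fin t → X) (B : ℕ) (T : ℝ) (i : ℕ) (hi : i ≤ m) :
    Measurable (fun p : Sample X Ω m n => (run A St B T p i hi).1) ∧
    Measurable (fun p : Sample X Ω m n => (run A St B T p i hi).2.budget) ∧
    Measurable (fun p : Sample X Ω m n => (run A St B T p i hi).2.threshold) := by
  induction i with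
  | zero =>
    refine ⟨measurable_const, measurable_const, ?_⟩
    simp only [run]
    fun_prop
  | succ i ih =>
    obtain ⟨h1, h2, h3⟩ := ih (Nat.le_of_succ_le hi)
    have hq : ∀ ω hist, A.query ⟨i, hi⟩ ω hist = A.extQuery ω i hist := fun ω hist => by
      have : i < m := hi
      simp [Analyst.extQuery, this]
    have hE : Measurable fun p : Sample X Ω m n => empiricalMean p.2.1
        (A.query ⟨i, hi⟩ p.1 (run A St B T p i (Nat.le_of_succ_le hi)).1) := by
      simp_rw [hq]
      exact (A.measurable_empiricalMean_extQuery (n := n) i).comp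
        (measurable_fst.prodMk ((measurable_fst.comp measurable_snd).prodMk h1))
    have hF : Measurable fun p : Sample X Ω m n => empiricalMean St
        (A.query ⟨i, hi⟩ p.1 (run A St B T p i (Nat.le_of_succ_le hi)).1) := by
      simp_rw [hq]
      exact (A.measurable_empiricalMean_extQuery (n := t) i).comp
        (measurable_fst.prodMk (measurable_const.prodMk h1))
    have hz : Measurable fun p : Sample X Ω m n => p.2.2.2 ⟨i, hi⟩ := by fun_prop
    have hs1 : MeasurableSet {p : Sample X Ω m n |
        (run A St B T p i (Nat.le_of_succ_le hi)).2.budget < 1} :=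
      measurableSet_lt h2 measurable_const
    have hs2 : MeasurableSet {p : Sample X Ω m n |
        |empiricalMean p.2.1 (A.query ⟨i, hi⟩ p.1 (run A St B T p i (Nat.le_of_succ_le hi)).1) -
          empiricalMean St (A.query ⟨i, hi⟩ p.1 (run A St B T p i (Nat.le_of_succ_le hi)).1)| >
        (run A St B T p i (Nat.le_of_succ_le hi)).2.threshold + (p.2.2.2 ⟨i, hi⟩).1} :=
      measurableSet_lt (h3.add hz.fst) (continuous_abs.measurable.comp (hE.sub hF))
    refine ⟨?_, ?_, ?_⟩
    · simp only [run]
      refine (measurable_snoc i).comp (h1.prodMk ?_)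
      simp only [step, apply_ite Prod.fst]
      exact Measurable.ite hs1 measurable_const (Measurable.ite hs2
        (measurable_inl.comp (hE.add hz.snd.fst)) (measurable_inl.comp hF))
    · simp only [run, step, apply_ite Prod.snd, apply_ite State.budget]
      exact Measurable.ite hs1 h2 (Measurable.ite hs2 (h2.sub_const 1) h2)
    · simp only [run, step, apply_ite Prod.snd, apply_ite State.threshold]
      exact Measurable.ite hs1 h3 (Measurable.ite hs2 (hz.snd.snd.const_add T) h3)

/-- The first `i` answers do not depend on the noise variables of the later queries. -/
lemma run_update (A : Analyst X Ω m) (St : Fin t → X) (B : ℕ) (T : ℝ) (ω : Ω) (S : Fin n → X)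
    (γ : ℝ) (z : Fin m → StepNoise) (j : Fin m) (w : StepNoise) (i : ℕ) (hi : i ≤ m)
    (hij : i ≤ j) :
    run A St B T (ω, S, γ, Function.update z j w) i hi = run A St B T (ω, S, γ, z) i hi := by
  induction i with
  | zero => rfl
  | succ i ih =>
    have hne : (⟨i, hi⟩ : Fin m) ≠ j := fun h => by
      have := congrArg Fin.val h
      simp only at this
      omega
    simp only [run, ih (Nat.le_of_succ_le hi) (by omega), Function.update_of_ne hne]

/-- The law of the noise variables. -/
noncomputable def noiseLaw (σ : ℝ) (m : ℕ) : Measure (ℝ × (Fin m → StepNoise)) :=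
  (laplaceMeasure (2 * σ)).prod (Measure.pi fun _ : Fin m =>
    (laplaceMeasure (4 * σ)).prod ((laplaceMeasure σ).prod (laplaceMeasure (2 * σ))))

instance (σ : ℝ) (m : ℕ) : IsProbabilityMeasure (noiseLaw σ m) := by
  unfold noiseLaw; infer_instance

lemma stateValue_step {σ T : ℝ} (A : Analyst X Ω m) (St : Fin t → X) (ω : Ω) (S : Fin n → X)
    {h : (i : ℕ) → (Fin i → Answer) → ℝ≥0∞} (hh : ∀ i, Measurable (h i)) (k i : ℕ)
    (hist : Fin i → Answer) (s : State) :
    ∫⁻ z, stateValue σ T (fun i hist => empiricalMean S (A.extQuery ω i hist))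
        (fun i hist => empiricalMean St (A.extQuery ω i hist)) h k (i + 1)
        (step S St T s (A.extQuery ω i hist) z).2.budget
        (Fin.snoc hist (step S St T s (A.extQuery ω i hist) z).1)
        (step S St T s (A.extQuery ω i hist) z).2.threshold
      ∂((laplaceMeasure (4 * σ)).prod ((laplaceMeasure σ).prod (laplaceMeasure (2 * σ)))) =
    stateValue σ T (fun i hist => empiricalMean S (A.extQuery ω i hist))
        (fun i hist => empiricalMean St (A.extQuery ω i hist)) h (k + 1) i s.budget hist
        s.threshold := by
  obtain ⟨b, θ⟩ := s
  set e : (i : ℕ) → (Fin i → Answer) → ℝ := fun i hist => empiricalMean S (A.extQuery ω i hist)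
  set f : (i : ℕ) → (Fin i → Answer) → ℝ := fun i hist => empiricalMean St (A.extQuery ω i hist)
  have he : ∀ i, Measurable (e i) := fun i =>
    (A.measurable_empiricalMean_extQuery i).comp
      (measurable_const.prodMk (measurable_const.prodMk measurable_id))
  have hf : ∀ i, Measurable (f i) := fun i =>
    (A.measurable_empiricalMean_extQuery i).comp
      (measurable_const.prodMk (measurable_const.prodMk measurable_id))
  cases b with
  | zero => simp [step, stateValue, exhaustedValue]
  | succ b =>
    have hval : ∀ z : StepNoise, stateValue σ T e f h k (i + 1)
        (step S St T ⟨b + 1, θ⟩ (A.extQuery ω i hist) z).2.budget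
        (Fin.snoc hist (step S St T ⟨b + 1, θ⟩ (A.extQuery ω i hist) z).1)
        (step S St T ⟨b + 1, θ⟩ (A.extQuery ω i hist) z).2.threshold =
        if θ + z.1 < |e i hist - f i hist| then
          stateValue σ T e f h k (i + 1) b (Fin.snoc hist (Sum.inl (e i hist + z.2.1))) (T + z.2.2)
        else stateValue σ T e f h k (i + 1) (b + 1) (Fin.snoc hist (Sum.inl (f i hist))) θ := by
      intro z
      have hb : ¬ (b + 1 < 1) := by omega
      by_cases hc : θ + z.1 < |e i hist - f i hist|
      · have hc' : |empiricalMean S (A.extQuery ω i hist) -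
          empiricalMean St (A.extQuery ω i hist)| > θ + z.1 := hc
        simp [step, if_pos hc, if_pos hc', e]
      · have hc' : ¬ |empiricalMean S (A.extQuery ω i hist) -
          empiricalMean St (A.extQuery ω i hist)| > θ + z.1 := hc
        simp only [step, if_neg hb, if_neg hc, if_neg hc', f]
    simp_rw [hval]
    have hm1 : Measurable fun v : ℝ × ℝ => stateValue σ T e f h k (i + 1) b
        (Fin.snoc hist (Sum.inl (e i hist + v.1))) (T + v.2) := by
      refine (measurable_stateValue (σ := σ) (T := T) he hf hh k (i + 1)).comp
        (measurable_const.prodMk (Measurable.prodMk ((measurable_snoc i).comp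
          (measurable_const.prodMk (measurable_inl.comp ?_))) ?_)) <;> fun_prop
    have hm2 : Measurable fun z : StepNoise => if θ + z.1 < |e i hist - f i hist| then
          stateValue σ T e f h k (i + 1) b (Fin.snoc hist (Sum.inl (e i hist + z.2.1))) (T + z.2.2)
        else stateValue σ T e f h k (i + 1) (b + 1) (Fin.snoc hist (Sum.inl (f i hist))) θ :=
      Measurable.ite (measurableSet_lt (by fun_prop) measurable_const)
        (hm1.comp measurable_snd) measurable_const
    rw [lintegral_prod _ hm2.aemeasurable]
    change _ = ∫⁻ η, (if θ + η < |e i hist - f i hist| then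
        ∫⁻ ξ, budgetValue σ T e f h b k (i + 1) (Fin.snoc hist (Sum.inl (e i hist + ξ)))
          ∂laplaceMeasure σ
      else stateValue σ T e f h k (i + 1) (b + 1) (Fin.snoc hist (Sum.inl (f i hist))) θ)
      ∂laplaceMeasure (4 * σ)
    refine lintegral_congr fun η => ?_
    simp only
    split_ifs with hc
    · rw [lintegral_prod _ hm1.aemeasurable]
      refine lintegral_congr fun ξ => ?_
      exact lintegral_stateValue k (i + 1) b (Fin.snoc hist (Sum.inl (e i hist + ξ)))
    · simp

/-- The value functions compute the law of the first `N` answers. -/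
lemma lintegral_run_eq_budgetValue {σ T : ℝ} (A : Analyst X Ω m) (St : Fin t → X) (B : ℕ) (ω : Ω)
    (S : Fin n → X) {h : (i : ℕ) → (Fin i → Answer) → ℝ≥0∞} (hh : ∀ i, Measurable (h i)) (N : ℕ)
    (hN : N ≤ m) :
    ∫⁻ z, h N (run A St B T (ω, S, z) N hN).1 ∂noiseLaw σ m =
      budgetValue σ T (fun i hist => empiricalMean S (A.extQuery ω i hist))
        (fun i hist => empiricalMean St (A.extQuery ω i hist)) h B N 0 Fin.elim0 := by
  set e : (i : ℕ) → (Fin i → Answer) → ℝ := fun i hist => empiricalMean S (A.extQuery ω i hist)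
    with he_def
  set f : (i : ℕ) → (Fin i → Answer) → ℝ := fun i hist => empiricalMean St (A.extQuery ω i hist)
    with hf_def
  have he : ∀ i, Measurable (e i) := fun i =>
    (A.measurable_empiricalMean_extQuery i).comp
      (measurable_const.prodMk (measurable_const.prodMk measurable_id))
  have hf : ∀ i, Measurable (f i) := fun i =>
    (A.measurable_empiricalMean_extQuery i).comp
      (measurable_const.prodMk (measurable_const.prodMk measurable_id))
  have hrun : ∀ k i (hi : i ≤ m), Measurable fun z : ℝ × (Fin m → StepNoise) =>
      stateValue σ T e f h k i (run A St B T (ω, S, z) i hi).2.budget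
        (run A St B T (ω, S, z) i hi).1 (run A St B T (ω, S, z) i hi).2.threshold := by
    intro k i hi
    obtain ⟨h1, h2, h3⟩ := measurable_run (n := n) A St B T i hi
    have hc : Measurable fun z : ℝ × (Fin m → StepNoise) => (ω, S, z) :=
      measurable_const.prodMk (measurable_const.prodMk measurable_id)
    exact (measurable_stateValue he hf hh k i).comp
      ((h2.comp hc).prodMk ((h1.comp hc).prodMk (h3.comp hc)))
  -- the expected value of the current state is the same at all times
  have key : ∀ i (hi : i ≤ N), ∫⁻ z, stateValue σ T e f h (N - i) i
      (run A St B T (ω, S, z) i (hi.trans hN)).2.budget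
      (run A St B T (ω, S, z) i (hi.trans hN)).1
      (run A St B T (ω, S, z) i (hi.trans hN)).2.threshold ∂noiseLaw σ m =
      budgetValue σ T e f h B N 0 Fin.elim0 := by
    intro i
    induction i with
    | zero =>
      intro _
      have hm := hrun (N - 0) 0 (Nat.zero_le _)
      rw [noiseLaw, lintegral_prod _ hm.aemeasurable, ← lintegral_stateValue]
      simp [run]
    | succ i ih =>
      intro hi
      have hi' : i ≤ N := by omega
      have him : i < m := by omega
      have hk : N - i = (N - (i + 1)) + 1 := by omega
      have hq : ∀ hist, A.query ⟨i, him⟩ ω hist = A.extQuery ω i hist := fun hist => by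
        simp [Analyst.extQuery, him]
      rw [← ih hi']
      have hm := hrun (N - (i + 1)) (i + 1) (hi.trans hN)
      have hm' := hrun (N - i) i (hi'.trans hN)
      rw [noiseLaw, lintegral_prod _ hm.aemeasurable, lintegral_prod _ hm'.aemeasurable]
      refine lintegral_congr fun γ => ?_
      -- integrate first over the noise of the current query, on which the state does not depend
      refine (lintegral_pi_update _ (⟨i, him⟩ : Fin m)
        (hm.comp measurable_prodMk_left)).symm.trans ?_
      refine lintegral_congr fun z => ?_
      rw [hk, ← stateValue_step A St ω S hh]
      refine lintegral_congr fun w => ?_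
      simp only [Function.comp_apply, run, run_update A St B T ω S γ z ⟨i, him⟩ w i _ le_rfl,
        Function.update_self, hq, he_def, hf_def]
  rw [← key N le_rfl]
  refine lintegral_congr fun z => ?_
  rw [Nat.sub_self, stateValue_zero]

end Run
end Thresholdout

namespace Thresholdout

open ProbabilityTheory

/-! ### The law of the history as a kernel -/

section Kernel

variable {X Ω : Type*} [MeasurableSpace X] [MeasurableSpace Ω] {m n t : ℕ}

/-- The mechanism that maps the holdout set to the law of the first `i` answers, the analyst's
randomness `ω` being fixed. -/
noncomputable def historyKernel (σ : ℝ) (A : Analyst X Ω m) (St : Fin t → X) (B : ℕ) (T : ℝ)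
    (n : ℕ) (ω : Ω) (i : Fin m) : Kernel (Fin n → X) (Fin (i : ℕ) → Answer) where
  toFun S := (noiseLaw σ m).map fun z => (run A St B T (ω, S, z) i i.isLt.le).1
  measurable' := by
    have hm : Measurable fun q : (Fin n → X) × (ℝ × (Fin m → StepNoise)) =>
        (run A St B T (ω, q.1, q.2) i i.isLt.le).1 :=
      (measurable_run A St B T i i.isLt.le).1.comp (measurable_const.prodMk measurable_id)
    refine Measure.measurable_of_measurable_coe _ fun s hs => ?_
    have h1 : ∀ S, ((noiseLaw σ m).map fun z => (run A St B T (ω, S, z) i i.isLt.le).1) s =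
        noiseLaw σ m (Prod.mk S ⁻¹' ((fun q : (Fin n → X) × (ℝ × (Fin m → StepNoise)) =>
          (run A St B T (ω, q.1, q.2) i i.isLt.le).1) ⁻¹' s)) := fun S =>
      Measure.map_apply (hm.comp measurable_prodMk_left) hs
    simp_rw [h1]
    exact measurable_measure_prodMk_left (hm hs)

variable {σ T : ℝ} {A : Analyst X Ω m} {St : Fin t → X} {B : ℕ}

lemma historyKernel_apply (ω : Ω) (i : Fin m) (S : Fin n → X) :
    historyKernel σ A St B T n ω i S =
      (noiseLaw σ m).map fun z => (run A St B T (ω, S, z) i i.isLt.le).1 := rfl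

lemma measurable_history (ω : Ω) (i : Fin m) (S : Fin n → X) :
    Measurable fun z : ℝ × (Fin m → StepNoise) => (run A St B T (ω, S, z) i i.isLt.le).1 :=
  (measurable_run A St B T i i.isLt.le).1.comp
    (measurable_const.prodMk (measurable_const.prodMk measurable_id))

instance (ω : Ω) (i : Fin m) : IsMarkovKernel (historyKernel σ A St B T n ω i) :=
  ⟨fun S => Measure.isProbabilityMeasure_map (measurable_history ω i S).aemeasurable⟩

/-- A payoff for histories of length `N`, extended by `0` to histories of other lengths. -/
noncomputable def extPayoff {N : ℕ} (h : (Fin N → Answer) → ℝ≥0∞) (i : ℕ) (hist : Fin i → Answer) :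
    ℝ≥0∞ :=
  if hi : i = N then h fun j => hist (Fin.cast hi.symm j) else 0

lemma measurable_extPayoff {N : ℕ} {h : (Fin N → Answer) → ℝ≥0∞} (hh : Measurable h) (i : ℕ) :
    Measurable (extPayoff h i) := by
  unfold extPayoff
  split_ifs with hi
  · exact hh.comp (by fun_prop)
  · exact measurable_const

lemma lintegral_historyKernel (ω : Ω) (i : Fin m) (S : Fin n → X)
    {h : (Fin (i : ℕ) → Answer) → ℝ≥0∞} (hh : Measurable h) :
    ∫⁻ y, h y ∂historyKernel σ A St B T n ω i S =
      budgetValue σ T (fun i hist => empiricalMean S (A.extQuery ω i hist))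
        (fun i hist => empiricalMean St (A.extQuery ω i hist)) (extPayoff h) B i 0
        Fin.elim0 := by
  rw [historyKernel_apply, lintegral_map hh (measurable_history ω i S),
    ← lintegral_run_eq_budgetValue A St B ω S (measurable_extPayoff hh) i i.isLt.le]
  simp [extPayoff]

lemma measurable_empiricalMean_extQuery_hist (ω : Ω) (S : Fin n → X) (i : ℕ) :
    Measurable fun hist : Fin i → Answer => empiricalMean S (A.extQuery ω i hist) :=
  (A.measurable_empiricalMean_extQuery i).comp
    (measurable_const.prodMk (measurable_const.prodMk measurable_id))

lemma abs_empiricalMean_extQuery_sub_le (ω : Ω) (S : Fin n → X) (j : Fin n) (x : X) (i : ℕ)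
    (hist : Fin i → Answer) :
    |empiricalMean S (A.extQuery ω i hist) -
      empiricalMean (Function.update S j x) (A.extQuery ω i hist)| ≤ 1 / n := by
  rw [abs_sub_comm]
  exact abs_empiricalMean_update_sub_le (A.extQuery_mem ω i hist) S j x

lemma historyKernel_pure (hσ : 0 < σ) (ω : Ω) (i : Fin m) (S : Fin n → X) (j : Fin n) (x : X)
    (h : (Fin (i : ℕ) → Answer) → ℝ≥0∞) (hh : Measurable h) :
    ∫⁻ y, h y ∂historyKernel σ A St B T n ω i S ≤
      ENNReal.ofReal (Real.exp (B * (2 * (1 / n) / σ))) *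
        ∫⁻ y, h y ∂historyKernel σ A St B T n ω i (Function.update S j x) := by
  rw [lintegral_historyKernel ω i S hh, lintegral_historyKernel ω i _ hh, Real.exp_nat_mul,
    ENNReal.ofReal_pow (Real.exp_pos _).le]
  exact budgetValue_le hσ (fun i => measurable_empiricalMean_extQuery_hist ω S i)
    (fun i => measurable_empiricalMean_extQuery_hist ω _ i)
    (fun i => measurable_empiricalMean_extQuery_hist ω St i) (measurable_extPayoff hh)
    (fun i hist => abs_empiricalMean_extQuery_sub_le ω S j x i hist) B i 0 Fin.elim0

lemma historyKernel_approx (hσ : 0 < σ) {α s : ℝ} (hα : 1 < α) (hs : 0 < s) (ω : Ω) (i : Fin m)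
    (S : Fin n → X) (j : Fin n) (x : X)
    (h : (Fin (i : ℕ) → Answer) → ℝ≥0∞) (hh : Measurable h) (hh1 : ∀ y, h y ≤ 1) :
    ∫⁻ y, h y ∂historyKernel σ A St B T n ω i S ≤
      ENNReal.ofReal (Real.exp (B * (α * (2 * (1 / n) / σ) ^ 2 / 2)) * s ^ (-α⁻¹)) *
        ∫⁻ y, h y ∂historyKernel σ A St B T n ω i (Function.update S j x) +
      ENNReal.ofReal (Real.exp (B * (α * (2 * (1 / n) / σ) ^ 2 / 2)) * s ^ (-α⁻¹) * (s / α)) := by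
  have hn : (0 : ℝ) < n := by exact_mod_cast j.pos
  rw [lintegral_historyKernel ω i S hh, lintegral_historyKernel ω i _ hh]
  refine budgetValue_le_linear hσ (fun i => measurable_empiricalMean_extQuery_hist ω S i)
    (fun i => measurable_empiricalMean_extQuery_hist ω _ i)
    (fun i => measurable_empiricalMean_extQuery_hist ω St i) (measurable_extPayoff hh)
    (fun i hist => ?_) (by positivity)
    (fun i hist => abs_empiricalMean_extQuery_sub_le ω S j x i hist) hα hs B i 0 Fin.elim0
  unfold extPayoff
  split_ifs
  · exact hh1 _
  · exact zero_le_one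

/-! ### Generalization of the queries of the analyst -/

variable {P : Measure X} [IsProbabilityMeasure P]

lemma historyKernel_gap_le_of_pure {τ b : ℝ} (hB : 0 < B) (hσ : 0 < σ) (hτ : 0 < τ) (hb : 0 < b)
    (hn : n₀ B σ τ b ≤ n) (ω : Ω) (i : Fin m) {φ : (Fin (i : ℕ) → Answer) → X → ℝ}
    (hφ : Measurable (Function.uncurry φ)) (h01 : ∀ y x, φ y x ∈ Set.Icc (0 : ℝ) 1) :
    ∫⁻ S, historyKernel σ A St B T n ω i S {y | τ ≤ empiricalMean S (φ y) - ∫ x, φ y x ∂P}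
      ∂Measure.pi (fun _ => P) ≤ ENNReal.ofReal (b / 2) := by
  have hB' : (0 : ℝ) < B := by exact_mod_cast hB
  have h1 : 2 * B / (σ * τ) ≤ n := (le_max_left _ _).trans hn
  have h2 : Real.log (6 / b) / τ ^ 2 ≤ n := (le_max_right _ _).trans hn
  have hn0 : (0 : ℝ) < n := lt_of_lt_of_le (by positivity) h1
  refine (lintegral_measure_gap_le_of_pure (τ := τ) (ε := B * (2 * (1 / n) / σ)) (by positivity)
    ?_ hφ h01 fun S j x h hh => historyKernel_pure hσ ω i S j x h hh).trans ?_
  · rw [div_le_iff₀ (by positivity)] at h1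
    have : (B : ℝ) * (2 * (1 / n) / σ) = 2 * B / (n * σ) := by field_simp
    rw [this, div_le_iff₀ (by positivity)]
    linarith
  · apply ENNReal.ofReal_le_ofReal
    rw [div_le_iff₀ (by positivity)] at h2
    calc Real.exp (-(n * τ ^ 2)) ≤ Real.exp (-Real.log (6 / b)) := Real.exp_le_exp.2 (by linarith)
      _ = b / 6 := by rw [Real.exp_neg, Real.exp_log (by positivity), inv_div]
      _ ≤ b / 2 := by linarith

/-- A choice of the order `α` of the Rényi divergence and of the slope `l` of the weight for which
concentrated privacy implies generalization. The parameter in Young's inequality is `b / 2`. -/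
lemma exists_approx_parameters {τ b : ℝ} (hB : 0 < B) (hτ : 0 < τ) (hτ1 : τ ≤ 1)
    (hb : 0 < b) (hb2 : b ≤ 1 / 2) (hσ : σ = τ / (12 * Real.log (2 / b)))
    (hn : n₁ B σ τ b ≤ n) :
    0 < σ ∧ 0 < n ∧ ∃ α l a : ℝ, 1 < α ∧ 1 ≤ l * τ ∧
      a = Real.exp (B * (α * (2 * (1 / n) / σ) ^ 2 / 2)) * (b / 2) ^ (-α⁻¹) ∧
      a * Real.exp (l * (1 / n)) ≤ 1 + τ / 4 ∧
      4 * (a * (b / 2 / α)) / τ + 2 * Real.exp (-(l * τ / 2)) ≤ b / 2 := by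
  have hB' : (1 : ℝ) ≤ B := by exact_mod_cast hB
  obtain ⟨L, hL⟩ : ∃ L, L = Real.log (2 / b) := ⟨_, rfl⟩
  obtain ⟨R, hR⟩ : ∃ R, R = Real.log (1 / (τ * b)) := ⟨_, rfl⟩
  rw [← hL] at hσ
  have hlog2 := Real.log_two_gt_d9
  have hlb : Real.log 2 ≤ Real.log (1 / b) := by
    apply Real.log_le_log two_pos
    rw [le_div_iff₀ hb]; linarith
  have hLb : L = Real.log 2 + Real.log (1 / b) := by
    rw [hL, ← Real.log_mul two_ne_zero (by positivity)]
    congr 1; ring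
  have hRb : Real.log (1 / b) ≤ R := by
    rw [hR]
    apply Real.log_le_log (by positivity)
    apply one_div_le_one_div_of_le (by positivity)
    exact mul_le_of_le_one_left hb.le hτ1
  have hL1 : 1 < L := by linarith
  have hL0 : 0 < L := by linarith
  have hLR : L ≤ 2 * R := by linarith
  have hR0 : 0 < R := by linarith
  have hσ0 : 0 < σ := by rw [hσ]; positivity
  obtain ⟨r, hr⟩ : ∃ r, r = Real.sqrt (B * R) := ⟨_, rfl⟩
  have hr2 : r ^ 2 = B * R := by rw [hr]; exact Real.sq_sqrt (by positivity)
  have hr1 : 4 / 5 ≤ r := by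
    rw [hr]
    apply Real.le_sqrt_of_sq_le
    have : R ≤ B * R := le_mul_of_one_le_left hR0.le hB'
    norm_num
    linarith
  have hn1 : 80 * r ≤ n * (τ * σ) := by
    rw [n₁, ← hR, ← hr, div_le_iff₀ (by positivity)] at hn
    exact hn
  have hn0' : (0 : ℝ) < n := by
    by_contra h
    have : (n : ℝ) * (τ * σ) ≤ 0 := mul_nonpos_of_nonpos_of_nonneg (not_lt.1 h) (by positivity)
    linarith
  have hn0 : 0 < n := by exact_mod_cast hn0'
  have hn2 : 960 * L * r ≤ n * τ ^ 2 := by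
    rw [hσ] at hn1
    have : (n : ℝ) * (τ * (τ / (12 * L))) = n * τ ^ 2 / (12 * L) := by field_simp
    rw [this, le_div_iff₀ (by positivity)] at hn1
    linarith
  obtain ⟨α, hα⟩ : ∃ α, α = 32 * L / τ := ⟨_, rfl⟩
  have hα1 : 1 < α := by
    rw [hα, lt_div_iff₀ hτ]; linarith
  have hs : 0 < b / 2 := by positivity
  obtain ⟨a, ha⟩ : ∃ a, a = Real.exp (B * (α * (2 * (1 / n) / σ) ^ 2 / 2)) * (b / 2) ^ (-α⁻¹) :=
    ⟨_, rfl⟩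
  have ha_le : a ≤ Real.exp (τ / 50 + τ / 32) := by
    rw [ha, Real.exp_add]
    refine mul_le_mul (Real.exp_le_exp.2 ?_) (le_of_eq ?_) (by positivity) (by positivity)
    · have h1 : (B : ℝ) * (α * (2 * (1 / n) / σ) ^ 2 / 2) = 64 * L * B * τ / (n * (τ * σ)) ^ 2 := by
        rw [hα]; field_simp; ring
      have h2 : 6400 * (B * R) ≤ (n * (τ * σ)) ^ 2 := by
        rw [← hr2]
        calc 6400 * r ^ 2 = (80 * r) ^ 2 := by ring
          _ ≤ _ := by gcongr
      rw [h1, div_le_iff₀ (by positivity)]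
      calc 64 * L * B * τ ≤ 64 * (2 * R) * B * τ := by gcongr
        _ = τ / 50 * (6400 * (B * R)) := by ring
        _ ≤ _ := by gcongr
    · rw [Real.rpow_def_of_pos hs]
      congr 1
      have h1 : Real.log (b / 2) = -L := by
        rw [hL, ← Real.log_inv, inv_div]
      rw [h1, hα]
      field_simp
  have ha0 : 0 ≤ a := by rw [ha]; positivity
  obtain ⟨l, hl⟩ : ∃ l, l = 2 / τ * Real.log (8 / b) := ⟨_, rfl⟩
  have h8 : Real.log (8 / b) = 2 * Real.log 2 + L := by
    rw [hL, two_mul, ← Real.log_mul two_ne_zero two_ne_zero,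
      ← Real.log_mul (by norm_num) (by positivity)]
    congr 1; ring
  have hlτ : l * τ = 2 * Real.log (8 / b) := by rw [hl]; field_simp
  have hln : l * (1 / n) ≤ τ / 192 := by
    have h1 : l * (1 / n) = 2 * Real.log (8 / b) / (τ * n) := by rw [hl]; field_simp
    rw [h1, div_le_iff₀ (by positivity)]
    calc 2 * Real.log (8 / b) ≤ 960 * L * (4 / 5) / 192 := by linarith
      _ ≤ 960 * L * r / 192 := by gcongr
      _ ≤ n * τ ^ 2 / 192 := by gcongr
      _ = _ := by ring
  have hexp : Real.exp (τ / 16) ≤ 1 + τ / 4 := by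
    have h1 := Real.abs_exp_sub_one_sub_id_le (x := τ / 16) (by rw [abs_of_pos] <;> linarith)
    have h2 := (abs_le.1 h1).2
    have h3 : (τ / 16) ^ 2 ≤ τ / 16 := by
      rw [sq]; exact mul_le_of_le_one_left (by positivity) (by linarith)
    linarith
  have hal : a * Real.exp (l * (1 / n)) ≤ 1 + τ / 4 := by
    refine le_trans ?_ hexp
    calc a * Real.exp (l * (1 / n)) ≤ Real.exp (τ / 50 + τ / 32) * Real.exp (τ / 192) := by
          gcongr
      _ = Real.exp (τ / 50 + τ / 32 + τ / 192) := (Real.exp_add _ _).symm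
      _ ≤ _ := Real.exp_le_exp.2 (by linarith)
  have ha2 : a ≤ 2 := by
    refine ha_le.trans (le_trans (Real.exp_le_exp.2 ?_) (hexp.trans ?_)) <;> linarith
  refine ⟨hσ0, hn0, α, l, a, hα1, by rw [hlτ]; linarith, ha, hal, ?_⟩
  have h1 : Real.exp (-(l * τ / 2)) = b / 8 := by
    rw [hlτ, mul_div_cancel_left₀ _ two_ne_zero, Real.exp_neg, Real.exp_log (by positivity), inv_div]
  have h2 : 4 * (a * (b / 2 / α)) / τ = a * b / (16 * L) := by
    rw [hα]; field_simp; ring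
  have h3 : a * b / (16 * L) ≤ b / 4 := by
    rw [div_le_iff₀ (by positivity)]
    have : a * b ≤ 4 * L * b := mul_le_mul_of_nonneg_right (by linarith) hb.le
    linarith
  rw [h1, h2]
  linarith

lemma historyKernel_gap_le_of_approx {τ b : ℝ} (hB : 0 < B) (hτ : 0 < τ) (hτ1 : τ ≤ 1)
    (hb : 0 < b) (hb2 : b ≤ 1 / 2) (hσ : σ = τ / (12 * Real.log (2 / b)))
    (hn : n₁ B σ τ b ≤ n) (ω : Ω) (i : Fin m) {φ : (Fin (i : ℕ) → Answer) → X → ℝ}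
    (hφ : Measurable (Function.uncurry φ)) (h01 : ∀ y x, φ y x ∈ Set.Icc (0 : ℝ) 1) :
    ∫⁻ S, historyKernel σ A St B T n ω i S {y | τ ≤ empiricalMean S (φ y) - ∫ x, φ y x ∂P}
      ∂Measure.pi (fun _ => P) ≤ ENNReal.ofReal (b / 2) := by
  obtain ⟨hσ0, hn0, α, l, a, hα, hl, ha, hal, hfin⟩ :=
    exists_approx_parameters hB hτ hτ1 hb hb2 hσ hn
  have ha0 : 0 ≤ a := by rw [ha]; positivity
  refine (lintegral_measure_gap_le_of_approx (τ := τ) (l := l) (a := a) (d := a * (b / 2 / α))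
    hn0 hτ hl ha0 (by positivity) hal hφ h01 fun S j x h hh hh1 => ?_).trans
    (ENNReal.ofReal_le_ofReal hfin)
  rw [ha]
  exact historyKernel_approx hσ0 hα (by positivity) ω i S j x h hh hh1

variable {μ : Measure Ω} [IsProbabilityMeasure μ]

lemma query_eq_extQuery (p : Sample X Ω m n) (i : Fin m) :
    query A St B T p i = A.extQuery p.1 i (run A St B T p i i.isLt.le).1 := by
  simp [query, Analyst.extQuery]

/-- Two-sided deviations on the whole probability space, from one-sided ones conditionally on the
randomness of the analyst. -/
lemma law_abs_gap_le {τ b : ℝ} (hn : 0 < n) (i : Fin m)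
    (hgap : ∀ ω, ∀ φ : (Fin (i : ℕ) → Answer) → X → ℝ, Measurable (Function.uncurry φ) →
      (∀ y x, φ y x ∈ Set.Icc (0 : ℝ) 1) →
      ∫⁻ S, historyKernel σ A St B T n ω i S {y | τ ≤ empiricalMean S (φ y) - ∫ x, φ y x ∂P}
        ∂Measure.pi (fun _ => P) ≤ ENNReal.ofReal (b / 2)) :
    law μ P σ m n {p | τ ≤ |empiricalMean p.2.1 (query A St B T p i) -
      ∫ x, query A St B T p i x ∂P|} ≤ ENNReal.ofReal b := by
  have hb : ENNReal.ofReal (b / 2) + ENNReal.ofReal (b / 2) = ENNReal.ofReal b := by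
    rcases le_total 0 b with h | h
    · rw [← ENNReal.ofReal_add (by positivity) (by positivity), add_halves]
    · rw [ENNReal.ofReal_of_nonpos (by linarith), ENNReal.ofReal_of_nonpos h, add_zero]
  have hrun := (measurable_run (n := n) A St B T i i.isLt.le).1
  have hint : Measurable fun q : Ω × (Fin (i : ℕ) → Answer) => ∫ x, A.extQuery q.1 i q.2 x ∂P := by
    have h1 : Measurable fun r : (Ω × (Fin (i : ℕ) → Answer)) × X => A.extQuery r.1.1 i r.1.2 r.2 :=
      (A.measurable_extQuery i).comp
        (f := fun r : (Ω × (Fin (i : ℕ) → Answer)) × X => (r.1.1, r.1.2, r.2)) (by fun_prop)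
    exact (h1.stronglyMeasurable.integral_prod_right (ν := P)).measurable
  have hms : MeasurableSet {p : Sample X Ω m n | τ ≤ |empiricalMean p.2.1 (query A St B T p i) -
      ∫ x, query A St B T p i x ∂P|} := by
    simp_rw [query_eq_extQuery]
    exact measurableSet_le measurable_const (continuous_abs.measurable.comp
      (((A.measurable_empiricalMean_extQuery i).comp
        (measurable_fst.prodMk ((measurable_fst.comp measurable_snd).prodMk hrun))).sub
        (hint.comp (measurable_fst.prodMk hrun))))
  change (μ.prod ((Measure.pi fun _ : Fin n => P).prod (noiseLaw σ m))) _ ≤ _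
  rw [Measure.prod_apply hms]
  refine (lintegral_mono (g := fun _ => ENNReal.ofReal b) fun ω => ?_).trans (by simp)
  rw [Measure.prod_apply (measurable_prodMk_left hms), ← hb]
  have hφ := A.measurable_uncurry_extQuery ω i
  refine le_trans ?_ (add_le_add (hgap ω (A.extQuery ω i) hφ (A.extQuery_mem ω i))
    (hgap ω (fun y x => 1 - A.extQuery ω i y x) (hφ.const_sub 1) fun y x => ?_))
  · have hm : MeasurableSet {q : (Fin n → X) × (Fin (i : ℕ) → Answer) |
        τ ≤ empiricalMean q.1 (A.extQuery ω i q.2) - ∫ x, A.extQuery ω i q.2 x ∂P} :=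
      measurableSet_le measurable_const ((measurable_empiricalMean hφ).sub
        ((measurable_integral_query hφ).comp measurable_snd))
    have hmK : Measurable fun S => historyKernel σ A St B T n ω i S
        {y | τ ≤ empiricalMean S (A.extQuery ω i y) - ∫ x, A.extQuery ω i y x ∂P} :=
      Kernel.measurable_kernel_prodMk_left hm
    rw [← lintegral_add_left hmK]
    refine lintegral_mono fun S => ?_
    have hS := measurable_history (A := A) (St := St) (B := B) (T := T) ω i S
    refine le_trans ?_ (measure_union_le _ _)
    rw [historyKernel_apply]
    refine le_trans (measure_mono ?_) (Measure.le_map_apply hS.aemeasurable _)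
    intro z hz
    simp only [Set.mem_preimage, Set.mem_ofPred_eq, query_eq_extQuery] at hz
    rcases le_abs.1 hz with h | h
    · exact Or.inl h
    · refine Or.inr ?_
      have hn' : (n : ℝ) ≠ 0 := by exact_mod_cast hn.ne'
      simp only [Set.mem_ofPred_eq]
      have hi : Integrable (fun x => A.extQuery ω i (run A St B T (ω, S, z) i i.isLt.le).1 x) P :=
        integrable_of_mem_Icc (hφ.comp measurable_prodMk_left) (A.extQuery_mem ω i _)
      rw [integral_sub (integrable_const _) hi, empiricalMean, Finset.sum_sub_distrib, sub_div]
      simp only [Finset.sum_const, Finset.card_univ, Fintype.card_fin, nsmul_eq_mul, mul_one,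
        integral_const, probReal_univ, smul_eq_mul, div_self hn']
      rw [empiricalMean] at h
      linarith
  · have := A.extQuery_mem ω i y x
    exact ⟨by linarith [this.2], by linarith [this.1]⟩

end Kernel
end Thresholdout

namespace Thresholdout

/-! ### Tails of the noise and of the query deviations -/

section Accuracy

variable {X Ω : Type*} [MeasurableSpace X] [MeasurableSpace Ω] {m n t : ℕ}
  {P : Measure X} [IsProbabilityMeasure P] {μ : Measure Ω} [IsProbabilityMeasure μ]
  {A : Analyst X Ω m} {St : Fin t → X} {B : ℕ}

/-- Each of the two lower bounds on the sample size comes from one of the two generalization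
bounds. The second bound asks for an accuracy of at most `1`, and for `τ / 8 > 1` there is nothing
to show. -/
lemma law_query_gap_le {β τ T : ℝ} (hβ : 0 < β) (hβ1 : β < 1) (hτ : 0 < τ) (hB : 0 < B)
    (hn : sampleBound m B τ β ≤ n) (i : Fin m) :
    law μ P (noiseRate m τ β) m n {p | τ / 8 ≤ |empiricalMean p.2.1 (query A St B T p i) -
      ∫ x, query A St B T p i x ∂P|} ≤ ENNReal.ofReal (β / (2 * m)) := by
  have hm : (1 : ℝ) ≤ m := by exact_mod_cast i.pos
  have hb : 0 < β / (2 * m) := by positivity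
  have hb2 : β / (2 * m) ≤ 1 / 2 := by
    rw [div_le_iff₀ (by positivity)]; linarith
  have hlog : 0 < Real.log (4 * m / β) := by
    apply Real.log_pos
    rw [lt_div_iff₀ hβ]; linarith
  have hσ : 0 < noiseRate m τ β := by unfold noiseRate; positivity
  rcases min_le_iff.1 hn with h | h
  · have hB' : (0 : ℝ) < B := by exact_mod_cast hB
    have hn0' : (0 : ℝ) < n := lt_of_lt_of_le (by positivity) ((le_max_left _ _).trans h)
    have hn0 : 0 < n := by exact_mod_cast hn0'
    exact law_abs_gap_le hn0 i fun ω φ hφ h01 =>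
      historyKernel_gap_le_of_pure hB hσ (by positivity) hb h ω i hφ h01
  · rcases le_or_gt (τ / 8) 1 with hτ1 | hτ1
    · have hσ' : noiseRate m τ β = τ / 8 / (12 * Real.log (2 / (β / (2 * m)))) := by
        have : 2 / (β / (2 * m)) = 4 * m / β := by field_simp; ring
        rw [this, noiseRate]
        field_simp
        norm_num
      exact law_abs_gap_le (exists_approx_parameters hB (by positivity) hτ1 hb hb2 hσ' h).2.1 i
        fun ω φ hφ h01 =>
          historyKernel_gap_le_of_approx hB (by positivity) hτ1 hb hb2 hσ' h ω i hφ h01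
    · -- both means lie in `[0, 1]`
      have : {p : Sample X Ω m n | τ / 8 ≤ |empiricalMean p.2.1 (query A St B T p i) -
          ∫ x, query A St B T p i x ∂P|} = ∅ := by
        refine Set.eq_empty_of_forall_notMem fun p hp => ?_
        have hq : ∀ x, query A St B T p i x ∈ Set.Icc (0 : ℝ) 1 := fun x => A.query_mem _ _ _ _
        have h1 := empiricalMean_mem_Icc hq p.2.1
        have h2 := integral_mem_Icc (P := P) hq
        have h3 : |empiricalMean p.2.1 (query A St B T p i) -
            ∫ x, query A St B T p i x ∂P| ≤ 1 := by
          rw [abs_le]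
          constructor <;> linarith [h1.1, h1.2, h2.1, h2.2]
        have h4 : τ / 8 ≤ _ := hp
        linarith
      rw [this, measure_empty]
      exact zero_le

lemma measurePreserving_initialNoise (σ : ℝ) :
    MeasurePreserving (fun p : Sample X Ω m n => p.2.2.1) (law μ P σ m n)
      (laplaceMeasure (2 * σ)) :=
  measurePreserving_fst.comp (measurePreserving_snd.comp measurePreserving_snd)

lemma measurePreserving_stepNoise (σ : ℝ) (i : Fin m) :
    MeasurePreserving (fun p : Sample X Ω m n => p.2.2.2 i) (law μ P σ m n)
      ((laplaceMeasure (4 * σ)).prod ((laplaceMeasure σ).prod (laplaceMeasure (2 * σ)))) :=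
  (measurePreserving_eval _ i).comp
    (measurePreserving_snd.comp (measurePreserving_snd.comp measurePreserving_snd))

lemma law_noise_ge_le {ν : Measure ℝ} {b c L : ℝ} (hb : 0 < b) (hL : 0 ≤ L) (hc : c = 2 * L * b)
    {Z : Type*} [MeasurableSpace Z] {g : Z → ℝ} {κ : Measure Z}
    (hg : MeasurePreserving g κ ν) (hν : ν = laplaceMeasure b) :
    κ {z | c ≤ |g z|} ≤ ENNReal.ofReal (2 * Real.exp (-(2 * L))) := by
  have hs : MeasurableSet {x : ℝ | c ≤ |x|} :=
    measurableSet_le measurable_const continuous_abs.measurable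
  have h1 := hg.measure_preimage hs.nullMeasurableSet
  have h2 := laplaceMeasure_abs_ge_le hb (a := c) (by rw [hc]; positivity)
  have h3 : -c / b = -(2 * L) := by rw [hc]; field_simp
  rw [h3] at h2
  rw [hν] at h1
  exact h1.le.trans h2

/-! ### Accuracy on the event of small noise and small deviations -/

/-- While the noise and the deviations of the queries are small, every query above the threshold
counts as overfitting, so the budget spent is at most the number of overfitting queries. -/
lemma run_state_of_good {τ : ℝ} {p : Sample X Ω m n}
    (hgap : ∀ i, |empiricalMean p.2.1 (query A St B (3 * τ / 4) p i) -
      ∫ x, query A St B (3 * τ / 4) p i x ∂P| < τ / 8)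
    (hγ0 : |p.2.2.1| < τ / 24) (hη : ∀ i, |(p.2.2.2 i).1| < τ / 12)
    (hγ : ∀ i, |(p.2.2.2 i).2.2| < τ / 24) (V : Finset (Fin m))
    (hV : ∀ j, |∫ x, query A St B (3 * τ / 4) p j x ∂P -
      empiricalMean St (query A St B (3 * τ / 4) p j)| > τ / 2 → j ∈ V) (i : ℕ) (hi : i ≤ m) :
    |(run A St B (3 * τ / 4) p i hi).2.threshold - 3 * τ / 4| < τ / 24 ∧
    B ≤ (run A St B (3 * τ / 4) p i hi).2.budget + (V.filter fun j : Fin m => (j : ℕ) < i).card := by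
  induction i with
  | zero => simpa [run] using hγ0
  | succ i ih =>
    obtain ⟨h1, h2⟩ := ih (Nat.le_of_succ_le hi)
    have hmono : (V.filter fun j : Fin m => (j : ℕ) < i).card ≤
        (V.filter fun j : Fin m => (j : ℕ) < i + 1).card :=
      Finset.card_le_card fun j hj => by
        simp only [Finset.mem_filter] at hj ⊢
        exact ⟨hj.1, by omega⟩
    have hq : A.query ⟨i, hi⟩ p.1 (run A St B (3 * τ / 4) p i (Nat.le_of_succ_le hi)).1 =
      query A St B (3 * τ / 4) p ⟨i, hi⟩ := rfl
    simp only [run, step, hq]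
    split_ifs with hb hc
    · exact ⟨h1, by omega⟩
    · refine ⟨by simpa using hγ ⟨i, hi⟩, ?_⟩
      have hmem : (⟨i, hi⟩ : Fin m) ∈ V := by
        apply hV
        have g1 := abs_lt.1 (hgap ⟨i, hi⟩)
        have g2 := abs_lt.1 (hη ⟨i, hi⟩)
        have g3 := abs_lt.1 h1
        rcases lt_abs.1 hc with g | g
        · exact lt_abs.2 (Or.inl (by linarith))
        · exact lt_abs.2 (Or.inr (by linarith))
      have hcard : (V.filter fun j : Fin m => (j : ℕ) < i).card <
          (V.filter fun j : Fin m => (j : ℕ) < i + 1).card := by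
        refine Finset.card_lt_card (Finset.ssubset_iff.2 ⟨⟨i, hi⟩, by simp, fun j hj => ?_⟩)
        rcases Finset.mem_insert.1 hj with rfl | hj
        · simp [hmem]
        · simp only [Finset.mem_filter] at hj ⊢
          exact ⟨hj.1, by omega⟩
      simp only
      omega
    · exact ⟨h1, h2.trans (Nat.add_le_add_left hmono _)⟩

lemma exists_answer_of_good {τ : ℝ} {p : Sample X Ω m n}
    (hgap : ∀ i, |empiricalMean p.2.1 (query A St B (3 * τ / 4) p i) -
      ∫ x, query A St B (3 * τ / 4) p i x ∂P| < τ / 8)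
    (hγ0 : |p.2.2.1| < τ / 24) (hη : ∀ i, |(p.2.2.2 i).1| < τ / 12)
    (hξ : ∀ i, |(p.2.2.2 i).2.1| < τ / 48) (hγ : ∀ i, |(p.2.2.2 i).2.2| < τ / 24) (i : Fin m)
    (hZ : overfitCount P A St B (3 * τ / 4) τ p i < B) :
    ∃ a : ℝ, answer A St B (3 * τ / 4) p i = Sum.inl a ∧
      |a - ∫ x, query A St B (3 * τ / 4) p i x ∂P| < τ := by
  classical
  let V : Finset (Fin m) := Finset.univ.filter fun j => |∫ x, query A St B (3 * τ / 4) p j x ∂P -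
      empiricalMean St (query A St B (3 * τ / 4) p j)| > τ / 2
  obtain ⟨h1, h2⟩ := run_state_of_good (P := P) hgap hγ0 hη hγ V (fun j hj => by simp [V, hj])
    i i.isLt.le
  have hcount : (V.filter fun j : Fin m => (j : ℕ) < i).card ≤
      overfitCount P A St B (3 * τ / 4) τ p i := by
    unfold overfitCount
    refine Finset.card_le_card fun j hj => ?_
    simp only [V, Finset.mem_filter, Finset.mem_univ, true_and] at hj ⊢
    exact ⟨Fin.le_def.2 (by omega), hj.1⟩
  have hb : ¬ (run A St B (3 * τ / 4) p i i.isLt.le).2.budget < 1 := by omega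
  have hq : A.query i p.1 (run A St B (3 * τ / 4) p i i.isLt.le).1 =
      query A St B (3 * τ / 4) p i := rfl
  have hans : answer A St B (3 * τ / 4) p i =
      (step p.2.1 St (3 * τ / 4) (run A St B (3 * τ / 4) p i i.isLt.le).2
        (query A St B (3 * τ / 4) p i) (p.2.2.2 i)).1 := by
    simp [answer, run, Fin.snoc_last, hq]
  rw [hans, step, if_neg hb]
  have g1 := abs_lt.1 (hgap i)
  have g2 := abs_lt.1 (hη i)
  have g3 := abs_lt.1 h1
  have g4 := abs_lt.1 (hξ i)
  split_ifs with hc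
  · refine ⟨_, rfl, ?_⟩
    rw [abs_lt]
    constructor <;> linarith
  · refine ⟨_, rfl, ?_⟩
    have g5 := abs_le.1 (not_lt.1 hc)
    rw [abs_lt]
    constructor <;> linarith

/-- The accuracy guarantee, by a union bound over the deviations of the queries and the noise. -/
theorem law_inaccurate_le {β τ : ℝ} (hβ : 0 < β) (hτ : 0 < τ) (hB : 0 < B) (hBm : B ≤ m)
    (hn : sampleBound m B τ β ≤ n) :
    law μ P (noiseRate m τ β) m n {p | ∃ i : Fin m,
      overfitCount P A St B (3 * τ / 4) τ p i < B ∧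
      ∀ a : ℝ, answer A St B (3 * τ / 4) p i = Sum.inl a →
        τ ≤ |a - ∫ x, query A St B (3 * τ / 4) p i x ∂P|} ≤ ENNReal.ofReal β := by
  have hprob : IsProbabilityMeasure (law μ P (noiseRate m τ β) m n) := by
    unfold law; infer_instance
  rcases le_or_gt 1 β with hβ1 | hβ1
  · exact prob_le_one.trans (ENNReal.one_le_ofReal.2 hβ1)
  have hm : (1 : ℝ) ≤ m := by exact_mod_cast hB.trans_le hBm
  obtain ⟨L, hL⟩ : ∃ L, L = Real.log (4 * m / β) := ⟨_, rfl⟩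
  have hL0 : 0 < L := by
    rw [hL]
    apply Real.log_pos
    rw [lt_div_iff₀ hβ]; linarith
  obtain ⟨σ, hσ⟩ : ∃ σ, σ = noiseRate m τ β := ⟨_, rfl⟩
  have hσL : σ * L = τ / 96 := by
    rw [hσ, noiseRate, ← hL]; field_simp
  have hσ0 : 0 < σ := by rw [hσ, noiseRate, ← hL]; positivity
  rw [← hσ] at hprob ⊢
  let bad : Fin m → Set (Sample X Ω m n) := fun i =>
    {p | τ / 8 ≤ |empiricalMean p.2.1 (query A St B (3 * τ / 4) p i) -
      ∫ x, query A St B (3 * τ / 4) p i x ∂P|} ∪ {p | τ / 12 ≤ |(p.2.2.2 i).1|} ∪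
      {p | τ / 48 ≤ |(p.2.2.2 i).2.1|} ∪ {p | τ / 24 ≤ |(p.2.2.2 i).2.2|}
  have hsub : {p : Sample X Ω m n | ∃ i : Fin m,
      overfitCount P A St B (3 * τ / 4) τ p i < B ∧
      ∀ a : ℝ, answer A St B (3 * τ / 4) p i = Sum.inl a →
        τ ≤ |a - ∫ x, query A St B (3 * τ / 4) p i x ∂P|} ⊆
      {p | τ / 24 ≤ |p.2.2.1|} ∪ ⋃ i, bad i := by
    rintro p ⟨i, hZ, hp⟩
    by_contra hgood
    simp only [Set.mem_union, Set.mem_iUnion, not_or, not_exists, bad, Set.mem_ofPred_eq,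
      not_le] at hgood
    obtain ⟨a, ha, hlt⟩ := exists_answer_of_good (fun i => (hgood.2 i).1.1.1) hgood.1
      (fun i => (hgood.2 i).1.1.2) (fun i => (hgood.2 i).1.2) (fun i => (hgood.2 i).2) i hZ
    linarith [hp a ha]
  obtain ⟨δ, hδ⟩ : ∃ δ, δ = 2 * Real.exp (-(2 * L)) := ⟨_, rfl⟩
  have hδ0 : 0 < δ := by rw [hδ]; positivity
  have hδ2 : δ = β ^ 2 / (8 * m ^ 2) := by
    have : Real.exp (-(2 * L)) = (Real.exp (-L)) ^ 2 := by
      rw [← Real.exp_nat_mul]; congr 1; push_cast; ring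
    rw [hδ, this, Real.exp_neg, hL, Real.exp_log (by positivity)]
    field_simp
    norm_num
  have hstep := fun i : Fin m => measurePreserving_stepNoise (X := X) (Ω := Ω) (n := n) (P := P)
    (μ := μ) σ i
  have hbad : ∀ i, law μ P σ m n (bad i) ≤ ENNReal.ofReal (β / (2 * m) + 3 * δ) := by
    intro i
    have b1 : law μ P σ m n {p | τ / 8 ≤ |empiricalMean p.2.1 (query A St B (3 * τ / 4) p i) -
        ∫ x, query A St B (3 * τ / 4) p i x ∂P|} ≤ ENNReal.ofReal (β / (2 * m)) := by
      rw [hσ]; exact law_query_gap_le hβ hβ1 hτ hB hn i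
    have b2 : law μ P σ m n {p | τ / 12 ≤ |(p.2.2.2 i).1|} ≤ ENNReal.ofReal δ := by
      rw [hδ]
      exact law_noise_ge_le (b := 4 * σ) (by positivity) hL0.le (by linarith)
        (measurePreserving_fst.comp (hstep i)) rfl
    have b3 : law μ P σ m n {p | τ / 48 ≤ |(p.2.2.2 i).2.1|} ≤ ENNReal.ofReal δ := by
      rw [hδ]
      exact law_noise_ge_le (b := σ) hσ0 hL0.le (by linarith)
        (measurePreserving_fst.comp (measurePreserving_snd.comp (hstep i))) rfl
    have b4 : law μ P σ m n {p | τ / 24 ≤ |(p.2.2.2 i).2.2|} ≤ ENNReal.ofReal δ := by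
      rw [hδ]
      exact law_noise_ge_le (b := 2 * σ) (by positivity) hL0.le (by linarith)
        (measurePreserving_snd.comp (measurePreserving_snd.comp (hstep i))) rfl
    calc law μ P σ m n (bad i) ≤ ENNReal.ofReal (β / (2 * m)) + ENNReal.ofReal δ +
          ENNReal.ofReal δ + ENNReal.ofReal δ := by
          refine (measure_union_le _ _).trans (add_le_add ?_ b4)
          refine (measure_union_le _ _).trans (add_le_add ?_ b3)
          exact (measure_union_le _ _).trans (add_le_add b1 b2)
      _ = _ := by
          rw [← ENNReal.ofReal_add (by positivity) hδ0.le,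
            ← ENNReal.ofReal_add (by positivity) hδ0.le,
            ← ENNReal.ofReal_add (by positivity) hδ0.le]
          congr 1
          ring
  have hinit : law μ P σ m n {p | τ / 24 ≤ |p.2.2.1|} ≤ ENNReal.ofReal δ := by
    rw [hδ]
    exact law_noise_ge_le (b := 2 * σ) (by positivity) hL0.le (by linarith)
      (measurePreserving_initialNoise σ) rfl
  calc _ ≤ law μ P σ m n {p | τ / 24 ≤ |p.2.2.1|} + law μ P σ m n (⋃ i, bad i) :=
        (measure_mono hsub).trans (measure_union_le _ _)
    _ ≤ ENNReal.ofReal δ + ∑ _i : Fin m, ENNReal.ofReal (β / (2 * m) + 3 * δ) :=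
        add_le_add hinit ((measure_iUnion_fintype_le _ _).trans
          (Finset.sum_le_sum fun i _ => hbad i))
    _ = ENNReal.ofReal (δ + m * (β / (2 * m) + 3 * δ)) := by
        rw [Finset.sum_const, Finset.card_univ, Fintype.card_fin, nsmul_eq_mul,
          ← ENNReal.ofReal_natCast m, ← ENNReal.ofReal_mul (by positivity),
          ← ENNReal.ofReal_add hδ0.le (by positivity)]
    _ ≤ ENNReal.ofReal β := by
        apply ENNReal.ofReal_le_ofReal
        have h1 : (m : ℝ) * (β / (2 * m) + 3 * δ) = β / 2 + 3 * (m * δ) := by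
          field_simp
        have h2 : δ ≤ m * δ := le_mul_of_one_le_left hδ0.le hm
        have h3 : m * δ = β * (β / m) / 8 := by rw [hδ2]; field_simp
        have h4 : β / m ≤ 1 := by
          rw [div_le_one (by positivity)]; linarith
        have h5 : β * (β / m) ≤ β := mul_le_of_le_one_right hβ.le h4
        linarith

end Accuracy

/-! ### The order of magnitude of the sample size -/

theorem sampleBound_le {β τ : ℝ} {m B : ℕ} (hβ : 0 < β) (hβm : 2 * β ≤ m) (hτ : 0 < τ)
    (hτ1 : τ ≤ 1) (hB : 0 < B) :
    sampleBound m B τ β ≤ 600000 * (Real.log (m / β) / τ ^ 2) *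
      min (B : ℝ) (Real.sqrt (B * Real.log (m / (τ * β)))) := by
  have hB' : (1 : ℝ) ≤ B := by exact_mod_cast hB
  have hm : (0 : ℝ) < m := by linarith
  have hmβ : 2 ≤ m / β := by rwa [le_div_iff₀ hβ]
  obtain ⟨ℓ, hℓ⟩ : ∃ ℓ, ℓ = Real.log (m / β) := ⟨_, rfl⟩
  obtain ⟨R, hR⟩ : ∃ R, R = Real.log (m / (τ * β)) := ⟨_, rfl⟩
  have h2 : 0 < Real.log 2 := Real.log_pos (by norm_num)
  have hℓ2 : Real.log 2 ≤ ℓ := by rw [hℓ]; exact Real.log_le_log two_pos hmβ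
  have hℓ0 : 0 < ℓ := h2.trans_le hℓ2
  have hR2 : Real.log 2 ≤ R := by
    rw [hR]
    refine Real.log_le_log two_pos (hmβ.trans ?_)
    apply div_le_div_of_nonneg_left hm.le (by positivity)
    exact mul_le_of_le_one_left hβ.le hτ1
  have hpow : ∀ k : ℕ, ∀ x : ℝ, 0 < x → Real.log (2 ^ k * x) = k * Real.log 2 + Real.log x :=
    fun k x hx => by rw [Real.log_mul (by positivity) hx.ne', Real.log_pow]
  obtain ⟨L, hL⟩ : ∃ L, L = Real.log (4 * m / β) := ⟨_, rfl⟩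
  have hL3 : L ≤ 3 * ℓ := by
    have := hpow 2 (m / β) (by positivity)
    rw [hL, show (4 : ℝ) * m / β = 2 ^ 2 * (m / β) by ring, this, ← hℓ]
    push_cast
    linarith
  have hL0 : 0 < L := by
    rw [hL]
    refine Real.log_pos ?_
    rw [mul_div_assoc]; linarith
  have hσ : noiseRate m τ β = τ / (96 * L) := by rw [noiseRate, hL]
  rw [← hℓ, ← hR]
  have hc : 0 ≤ 600000 * (ℓ / τ ^ 2) := by positivity
  rw [mul_min_of_nonneg _ _ hc, sampleBound, hσ]
  refine min_le_min ?_ ?_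
  · refine max_le ?_ ?_
    · calc 2 * B / (τ / (96 * L) * (τ / 8)) = 1536 * L * B / τ ^ 2 := by field_simp; ring
        _ ≤ 1536 * (3 * ℓ) * B / τ ^ 2 := by gcongr
        _ = 4608 * (ℓ / τ ^ 2) * B := by ring
        _ ≤ 600000 * (ℓ / τ ^ 2) * B := by
          gcongr
          norm_num
    · have h12 : Real.log (6 / (β / (2 * m))) ≤ 5 * ℓ := by
        have h1 : 6 / (β / (2 * m)) ≤ 2 ^ 4 * (m / β) := by
          have : 6 / (β / (2 * m)) = 12 * (m / β) := by field_simp; ring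
          rw [this]
          gcongr
          norm_num
        refine (Real.log_le_log (by positivity) h1).trans ?_
        rw [hpow 4 _ (by positivity), ← hℓ]
        push_cast
        linarith
      calc Real.log (6 / (β / (2 * m))) / (τ / 8) ^ 2 ≤ 5 * ℓ / (τ / 8) ^ 2 := by gcongr
        _ = 320 * (ℓ / τ ^ 2) * 1 := by ring
        _ ≤ 600000 * (ℓ / τ ^ 2) * B := by
          gcongr
          norm_num
  · have h16 : Real.log (1 / (τ / 8 * (β / (2 * m)))) ≤ 9 * R := by
      have h1 : 1 / (τ / 8 * (β / (2 * m))) = 2 ^ 4 * (m / (τ * β)) := by field_simp; ring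
      rw [h1, hpow 4 _ (by positivity), ← hR]
      push_cast
      linarith
    have hs : Real.sqrt (B * Real.log (1 / (τ / 8 * (β / (2 * m))))) ≤ 3 * Real.sqrt (B * R) := by
      have h3 : 3 * Real.sqrt (B * R) = Real.sqrt (B * (9 * R)) := by
        rw [show (B : ℝ) * (9 * R) = 3 ^ 2 * (B * R) by ring, Real.sqrt_mul (sq_nonneg 3),
          Real.sqrt_sq zero_le_three]
      rw [h3]
      exact Real.sqrt_le_sqrt (by gcongr)
    calc 80 * Real.sqrt (B * Real.log (1 / (τ / 8 * (β / (2 * m))))) / (τ / 8 * (τ / (96 * L)))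
        = 61440 * L * Real.sqrt (B * Real.log (1 / (τ / 8 * (β / (2 * m))))) / τ ^ 2 := by
          field_simp; ring
      _ ≤ 61440 * (3 * ℓ) * (3 * Real.sqrt (B * R)) / τ ^ 2 := by gcongr
      _ = 552960 * (ℓ / τ ^ 2) * Real.sqrt (B * R) := by ring
      _ ≤ 600000 * (ℓ / τ ^ 2) * Real.sqrt (B * R) := by
          gcongr
          norm_num

end Thresholdout

theorem mainTheorem2 :
    -- the accuracy guarantee
    (∀ (X : Type*) [MeasurableSpace X] (P : Measure X) [IsProbabilityMeasure P]
      (Ω : Type*) [MeasurableSpace Ω] (μ : Measure Ω) [IsProbabilityMeasure μ]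
      (β τ : ℝ) (m B n t : ℕ) (St : Fin t → X) (A : Thresholdout.Analyst X Ω m),
      0 < β → 0 < τ → 0 < B → B ≤ m →
      Thresholdout.sampleBound m B τ β ≤ n →
      Thresholdout.law μ P (Thresholdout.noiseRate m τ β) m n
        {p | ∃ i : Fin m,
          Thresholdout.overfitCount P A St B (3 * τ / 4) τ p i < B ∧
          ∀ a : ℝ, Thresholdout.answer A St B (3 * τ / 4) p i = Sum.inl a →
            τ ≤ |a - ∫ x, Thresholdout.query A St B (3 * τ / 4) p i x ∂P|}
        ≤ ENNReal.ofReal β) ∧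
    -- the order of magnitude of the sample size
    (∃ C : ℝ, 0 < C ∧ ∀ (β τ : ℝ) (m B : ℕ),
      0 < β → 2 * β ≤ m → 0 < τ → τ ≤ 1 → 0 < B → B ≤ m →
      Thresholdout.sampleBound m B τ β ≤
        C * (Real.log (m / β) / τ ^ 2) *
          min (B : ℝ) (Real.sqrt (B * Real.log (m / (τ * β))))) :=
  ⟨fun _ _ _ _ _ _ _ _ _ _ _ _ _ _ _ _ hβ hτ hB hBm hn =>
    Thresholdout.law_inaccurate_le hβ hτ hB hBm hn,
    600000, by norm_num, fun _ _ _ _ hβ hβm hτ hτ1 hB _ =>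
      Thresholdout.sampleBound_le hβ hβm hτ hτ1 hB⟩
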